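/- Let $f:\mathbb{R}^{d_1}\times\mathbb{R}^{d_2}\to\mathbb{R}$ be differentiable and let $l\ge\mu>0$, $\kappa=l/\mu\ge 1$, $\sigma>0$. Assume the following. (i) ($l$-smoothness) For all $x_1,x_2,y_1,y_2$, both $\|\nabla_xf(x_1,y_1)-\nabla_xf(x_2,y_2)\|$ and $\|\nabla_yf(x_1,y_1)-\nabla_yf(x_2,y_2)\|$ are at most $l\,(\|x_1-x_2\|+\|y_1-y_2\|)$. (ii) ($\mu$-PL in $y$) For every $x$ the maximum $\Phi(x)=\max_yf(x,y)$ is finite and attained, and $\|\nabla_yf(x,y)\|^2\ge 2\mu\,(\Phi(x)-f(x,y))$ for all $x,y$. Moreover $\Phi$ is bounded below by a finite number $\Phi^*$. (iii) $G_x(x,y,\xi)$ and $G_y(x,y,\xi)$ are unbiased estimators of $\nabla_xf(x,y)$ and $\nabla_yf(x,y)$, each with variance at most $\sigma^2$ (that is, $\mathbb{E}\|G_x(x,y,\xi)-\nabla_xf(x,y)\|^2\le\sigma^2$ and $\mathbb{E}\|G_y(x,y,\xi)-\nabla_yf(x,y)\|^2\le\sigma^2$ for all $x,y$). Let $(x_0,y_0,z_0)$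 be an initial point with $\Delta=\Phi(z_0)-\Phi^*>0$, let $T\ge1$, and let Stochastic Smoothed-AGDA perform, for $t=0,\dots,T-1$, with samples $\xi_1^t,\xi_2^t$ (all i.i.d.), $$x_{t+1}=x_t-\tau_1[G_x(x_t,y_t,\xi_1^t)+p(x_t-z_t)],\quad y_{t+1}=y_t+\tau_2G_y(x_{t+1},y_t,\xi_2^t),\quad z_{t+1}=z_t+\beta(x_{t+1}-z_t),$$ where $\tau_1=\min\{\frac{\sqrt\Delta}{2\sigma\sqrt{Tl}},\frac1{3l}\}$, $\tau_2=\min\{\frac{\sqrt\Delta}{96\sigma\sqrt{Tl}},\frac1{144l}\}$, $p=2l$, $\beta=\frac{\tau_2\mu}{1600}$. The output $(\hat x,\hat y)$ is chosen uniformly from $\{(x_t,y_t)\}_{t=0}^{T-1}$, independently of the samples. Let $\hat f(x,y;z)=f(x,y)+\frac p2\|x-z\|^2$ and let $b_0=2\big[\max_y\hat f(x_0,y;z_0)-\min_x\hat f(x,y_0;z_0)\big]$ be twice the primal-dual gap of $\hat f(\cdot,\cdot;z_0)$ at $(x_0,y_0)$. Then, with universal constants $c_0,c_1,c_2$, $$\frac1T\sum_{t=0}^{T-1}\mathbb{E}\big\{\|\nabla_xf(x_t,y_t)\|^2+\kappa\|\nabla_yf(x_t,y_t)\|^2\big\}\le\frac{c_0l\kappa}{T}[\Delta+b_0]+\frac{c_1\kappa\sqrt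 l\,b_0}{\sqrt{\Delta T}}\sigma+\frac{c_2\kappa\sqrt{l\Delta}}{\sqrt T}\sigma .$$ Consequently, for every $\epsilon>0$, the output satisfies $\mathbb{E}\|\nabla_xf(\hat x,\hat y)\|\le\epsilon$ and $\mathbb{E}\|\nabla_yf(\hat x,\hat y)\|\le\epsilon/\sqrt\kappa$ (it is in expectation an $(\epsilon,\epsilon/\sqrt\kappa)$-stationary point of $f$) as soon as the number $2T$ of samples drawn is at least $$c\left(\frac{l\kappa(\Delta+b_0)}{\epsilon^2}+\frac{l\kappa^2(\Delta+b_0^2/\Delta)\sigma^2}{\epsilon^4}\right)$$ with a universal constant $c$. In particular, when $b_0=O(\Delta)$, i.e. $b_0\le M\Delta$, the sample complexity is $O\left(\frac{l\kappa\Delta}{\epsilon^2}+\frac{l\kappa^2\Delta\sigma^2}{\epsilon^4}\right)$, where the constant hidden in $O(\cdot)$ depends only on $M$. -/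

import Mathlib

open MeasureTheory ProbabilityTheory

noncomputable section

namespace SmoothedAGDA

/-- `ℝ^d` with the Euclidean norm. -/
abbrev Vec (d : ℕ) : Type := EuclideanSpace ℝ (Fin d)

/-- The partial gradient `∇ₓ f (x, y)`. -/
def gradX {d₁ d₂ : ℕ} (f : Vec d₁ → Vec d₂ → ℝ) (x : Vec d₁) (y : Vec d₂) : Vec d₁ :=
  gradient (fun x' => f x' y) x

/-- The partial gradient `∇_y f (x, y)`. -/
def gradY {d₁ d₂ : ℕ} (f : Vec d₁ → Vec d₂ → ℝ) (x : Vec d₁) (y : Vec d₂) : Vec d₂ :=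
  gradient (fun y' => f x y') y

/-- `f` is differentiable and `l`-Lipschitz smooth. -/
structure LipschitzSmooth {d₁ d₂ : ℕ} (f : Vec d₁ → Vec d₂ → ℝ) (l : ℝ) : Prop where
  differentiable : Differentiable ℝ (fun q : Vec d₁ × Vec d₂ => f q.1 q.2)
  lipschitz_x : ∀ x₁ x₂ y₁ y₂,
    ‖gradX f x₁ y₁ - gradX f x₂ y₂‖ ≤ l * (‖x₁ - x₂‖ + ‖y₁ - y₂‖)
  lipschitz_y : ∀ x₁ x₂ y₁ y₂,
    ‖gradY f x₁ y₁ - gradY f x₂ y₂‖ ≤ l * (‖x₁ - x₂‖ + ‖y₁ - y₂‖)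

/-- The primal function `Φ x = max_y f (x, y)`. -/
def primal {d₁ d₂ : ℕ} (f : Vec d₁ → Vec d₂ → ℝ) (x : Vec d₁) : ℝ := ⨆ y, f x y

/-- The Polyak-Łojasiewicz condition in `y`: the inner maximum is finite and attained, and
`‖∇_y f (x, y)‖² ≥ 2 μ (max_y' f (x, y') - f (x, y))`. -/
structure PLInY {d₁ d₂ : ℕ} (f : Vec d₁ → Vec d₂ → ℝ) (μ : ℝ) : Prop where
  max_attained : ∀ x, ∃ y₀, ∀ y, f x y ≤ f x y₀
  pl : ∀ x y, 2 * μ * (primal f x - f x y) ≤ ‖gradY f x y‖ ^ 2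

/-- `G (x, y, ξ)`, with `ξ` of law `D`, is an unbiased estimator of `g (x, y)` whose variance
is at most `σ²`. -/
structure StochasticGradient {d₁ d₂ d : ℕ} {Ξ : Type*} [MeasurableSpace Ξ] (D : Measure Ξ)
    (G : Vec d₁ → Vec d₂ → Ξ → Vec d) (g : Vec d₁ → Vec d₂ → Vec d) (σ : ℝ) : Prop where
  measurable : Measurable (fun q : Vec d₁ × Vec d₂ × Ξ => G q.1 q.2.1 q.2.2)
  integrable : ∀ x y, Integrable (G x y) D
  unbiased : ∀ x y, ∫ s, G x y s ∂D = g x y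
  integrable_sq : ∀ x y, Integrable (fun s => ‖G x y s - g x y‖ ^ 2) D
  variance_le : ∀ x y, ∫ s, ‖G x y s - g x y‖ ^ 2 ∂D ≤ σ ^ 2

/-- The auxiliary function `f̂ (x, y; z) = f (x, y) + p / 2 * ‖x - z‖²`. -/
def aux {d₁ d₂ : ℕ} (f : Vec d₁ → Vec d₂ → ℝ) (p : ℝ) (z : Vec d₁) (x : Vec d₁) (y : Vec d₂) : ℝ :=
  f x y + p / 2 * ‖x - z‖ ^ 2

/-- The primal-dual gap `max_y h (x, y) - min_x' h (x', y)` of `h` at `(x, y)`. -/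
def gap {d₁ d₂ : ℕ} (h : Vec d₁ → Vec d₂ → ℝ) (x : Vec d₁) (y : Vec d₂) : ℝ :=
  (⨆ y', h x y') - ⨅ x', h x' y

/-- A state of the algorithm: the three iterates and the number of samples drawn so far. -/
structure State (d₁ d₂ : ℕ) where
  x : Vec d₁
  y : Vec d₂
  z : Vec d₁
  drawn : ℕ

/-- One iteration of Stochastic Smoothed-AGDA, drawing the next two samples from the stream `s`. -/
def step {d₁ d₂ : ℕ} {Ξ : Type*} (Gx : Vec d₁ → Vec d₂ → Ξ → Vec d₁)
    (Gy : Vec d₁ → Vec d₂ → Ξ → Vec d₂) (τ₁ τ₂ p β : ℝ) (s : ℕ → Ξ) (w : State d₁ d₂) :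
    State d₁ d₂ :=
  let x' := w.x - τ₁ • (Gx w.x w.y (s w.drawn) + p • (w.x - w.z))
  let y' := w.y + τ₂ • Gy x' w.y (s (w.drawn + 1))
  let z' := w.z + β • (x' - w.z)
  ⟨x', y', z', w.drawn + 2⟩

/-- The state after `t` iterations of Stochastic Smoothed-AGDA started at `(x₀, y₀, z₀)`. -/
def run {d₁ d₂ : ℕ} {Ξ : Type*} (Gx : Vec d₁ → Vec d₂ → Ξ → Vec d₁)
    (Gy : Vec d₁ → Vec d₂ → Ξ → Vec d₂) (τ₁ τ₂ p β : ℝ)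
    (x₀ : Vec d₁) (y₀ : Vec d₂) (z₀ : Vec d₁) (s : ℕ → Ξ) : ℕ → State d₁ d₂
  | 0 => ⟨x₀, y₀, z₀, 0⟩
  | t + 1 => step Gx Gy τ₁ τ₂ p β s (run Gx Gy τ₁ τ₂ p β x₀ y₀ z₀ s t)

/-- `ξ 0, ξ 1, …` are i.i.d. random variables with law `D`. -/
structure IIDSamples {Ω Ξ : Type*} [MeasurableSpace Ω] [MeasurableSpace Ξ] (P : Measure Ω)
    (D : Measure Ξ) (ξ : ℕ → Ω → Ξ) : Prop where
  measurable : ∀ i, Measurable (ξ i)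
  law : ∀ i, P.map (ξ i) = D
  indep : iIndepFun ξ P

/-- `J` is uniformly distributed on `{0, …, T - 1}` and independent of the samples. -/
structure UniformIndex {Ω Ξ : Type*} [MeasurableSpace Ω] [MeasurableSpace Ξ] (P : Measure Ω)
    (ξ : ℕ → Ω → Ξ) (T : ℕ) (J : Ω → ℕ) : Prop where
  measurable : Measurable J
  uniform : ∀ t < T, P.real (J ⁻¹' {t}) = 1 / (T : ℝ)
  indep : IndepFun J (fun ω i => ξ i ω) P

/-- The random point `(X, Y)` is, in expectation, an `(ε₁, ε₂)`-stationary point of `f`. -/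
def IsExpectedStationary {d₁ d₂ : ℕ} {Ω : Type*} [MeasurableSpace Ω] (P : Measure Ω)
    (f : Vec d₁ → Vec d₂ → ℝ) (X : Ω → Vec d₁) (Y : Ω → Vec d₂) (ε₁ ε₂ : ℝ) : Prop :=
  (Integrable (fun ω => ‖gradX f (X ω) (Y ω)‖) P ∧ ∫ ω, ‖gradX f (X ω) (Y ω)‖ ∂P ≤ ε₁) ∧
  (Integrable (fun ω => ‖gradY f (X ω) (Y ω)‖) P ∧ ∫ ω, ‖gradY f (X ω) (Y ω)‖ ∂P ≤ ε₂)

end SmoothedAGDA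

end

/-!
# Convergence of Stochastic Smoothed-AGDA under the PL condition

The proof is a potential argument. Put `f̂(x, y; z) = f(x, y) + l ‖x - z‖²` (the auxiliary function
for `p = 2 l`), `Ψ(y; z) = min_x f̂(x, y; z)`, `P(z) = min_x max_y f̂(x, y; z)` and

  `V(x, y, z) = f̂(x, y; z) - 2 Ψ(y; z) + 2 P(z)`.

Since `f` is `l`-smooth, `f̂(·, y; z)` and the regularized primal function `Φ + l ‖· - z‖²` have an
`l`-strong subgradient at every point, so their minimizers `x*(y, z)` (`proxArg`) and `x*(z)`
(`primalProxArg`) exist and come with quadratic growth. Consequences are an error bound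
`l ‖x - x*(y, z)‖ ≤ ‖∇ₓ f̂‖` (`norm_sub_proxArg_le`), Lipschitz continuity of `x*(y, z)`
(`norm_proxArg_sub_le`) and, this being the only use of the PL inequality,
`l μ ‖x*(y, z) - x*(z)‖² ≤ ‖∇_y f(x*(y, z), y)‖²` (`norm_proxArg_sub_primalProxArg_sq_le`). The last
bound needs only weak duality, not a minimax theorem.

In one iteration the `x`-step decreases `f̂`, the `y`-step increases `Ψ`, which outweighs the
increase of `f̂` because `Ψ` is counted twice, and the `z`-step decreases `f̂` while the changes of
`2 P` and `- 2 Ψ` cancel up to the distance of `x*(y, z)` and `x*(z)`, which the PL bound absorbs as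
`β` is small. The outcome is `stationarity_le_potential_decrease`: for every realization of the
noise, `τ₂ (μ ‖∇ₓ f‖² + l ‖∇_y f‖²)` is at most a constant times `l` times the decrease of `V`, plus
terms linear and quadratic in the noise.

This inequality is summed before taking expectations, so neither measurability nor integrability of
`V` is ever needed: `V` is bounded below by `Φ*`, and its initial value is the constant
`V(x₀, y₀, z₀) ≤ Φ(z₀) + b₀`. The iterates before a sample are independent of it and square
integrable, so the linear noise terms have mean zero (`StochasticGradient.integral_inner_noise`) and
the quadratic ones are at most `σ²` in mean (`StochasticGradient.memLp_noise`). The step sizes make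
the accumulated noise at most `Δ`; dividing by `T τ₂ μ` gives the rate. The sample complexity follows
by inverting the rate, independence of the output index, and Jensen's inequality.
-/

noncomputable section

namespace SmoothedAGDA

/-! ### Smooth and strongly convex functions -/

/-- The quadratic bounds satisfied by a function with `L`-Lipschitz gradient. -/
lemma abs_sub_sub_inner_gradient_le {E : Type*} [NormedAddCommGroup E] [InnerProductSpace ℝ E]
    [CompleteSpace E] {φ : E → ℝ} {L : ℝ} (hd : Differentiable ℝ φ)
    (hL : ∀ a b, ‖gradient φ a - gradient φ b‖ ≤ L * ‖a - b‖) (x y : E) :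
    |φ y - φ x - inner ℝ (gradient φ x) (y - x)| ≤ L / 2 * ‖y - x‖ ^ 2 := by
  set v := y - x with hv
  have hline : ∀ t : ℝ, HasDerivAt (fun t : ℝ => x + t • v) v t := fun t => by
    simpa using ((hasDerivAt_id t).smul_const v).const_add x
  have hder : ∀ t : ℝ, HasDerivAt
      (fun t : ℝ => φ (x + t • v) - φ x - t * inner ℝ (gradient φ x) v)
      (inner ℝ (gradient φ (x + t • v) - gradient φ x) v) t := fun t => by
    have h1 := (hd (x + t • v)).hasFDerivAt.comp_hasDerivAt t (hline t)
    have h2 := (hasDerivAt_id t).mul_const (inner ℝ (gradient φ x) v)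
    have h3 := (h1.sub_const (φ x)).sub h2
    rw [← inner_gradient_left] at h3
    rw [inner_sub_left]
    rw [one_mul] at h3
    exact h3
  have key := image_norm_le_of_norm_deriv_right_le_deriv_boundary (a := 0) (b := 1)
    (f := fun t : ℝ => φ (x + t • v) - φ x - t * inner ℝ (gradient φ x) v)
    (B := fun t : ℝ => L * ‖v‖ ^ 2 / 2 * t ^ 2)
    (B' := fun t : ℝ => L * ‖v‖ ^ 2 / 2 * (2 * t))
    (fun t _ => (hder t).continuousAt.continuousWithinAt)
    (fun t _ => (hder t).hasDerivWithinAt) (by simp)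
    (fun t => by simpa using (hasDerivAt_pow 2 t).const_mul (L * ‖v‖ ^ 2 / 2))
    (fun t ht => ?_) (Set.right_mem_Icc.2 zero_le_one)
  · have : x + (1 : ℝ) • v = y := by simp [hv]
    simp only [this, Real.norm_eq_abs, one_mul] at key
    linarith
  · have h1 := hL (x + t • v) x
    rw [add_sub_cancel_left, norm_smul, Real.norm_of_nonneg ht.1] at h1
    calc ‖inner ℝ (gradient φ (x + t • v) - gradient φ x) v‖
        ≤ ‖gradient φ (x + t • v) - gradient φ x‖ * ‖v‖ := norm_inner_le_norm _ _
      _ ≤ L * (t * ‖v‖) * ‖v‖ := by gcongr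
      _ = _ := by ring

/-- A lower semicontinuous function on a finite-dimensional space that has, at every point, an
`m`-strong subgradient attains its minimum and grows quadratically away from the minimizer. -/
lemma exists_forall_add_sq_le {E : Type*} [NormedAddCommGroup E] [InnerProductSpace ℝ E]
    [FiniteDimensional ℝ E] {φ : E → ℝ} {m : ℝ} (hm : 0 < m) (hlsc : LowerSemicontinuous φ)
    (hsub : ∀ x, ∃ s, ∀ x', φ x + inner ℝ s (x' - x) + m / 2 * ‖x' - x‖ ^ 2 ≤ φ x') :
    ∃ x, ∀ x', φ x + m / 4 * ‖x' - x‖ ^ 2 ≤ φ x' := by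
  have : ProperSpace E := FiniteDimensional.proper ℝ E
  obtain ⟨s, hs⟩ := hsub 0
  set R := 2 * ‖s‖ / m
  have hR : 0 ≤ R := by positivity
  obtain ⟨a, -, ha⟩ := LowerSemicontinuousOn.exists_isMinOn
    (s := Metric.closedBall (0 : E) R) ⟨0, by simpa using hR⟩ (isCompact_closedBall 0 R)
    (hlsc.lowerSemicontinuousOn _)
  -- outside the ball of radius `R` the quadratic term of the subgradient bound at `0` wins
  have hmin : ∀ x, φ a ≤ φ x := fun x => by
    by_cases hx : ‖x‖ ≤ R
    · exact ha (by simpa using hx)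
    · have h0 : φ a ≤ φ 0 := ha (by simpa using hR)
      have h1 := hs x
      have h2 := neg_le_of_abs_le (abs_real_inner_le_norm s (x - 0))
      rw [sub_zero] at h1 h2
      have h3 : 2 * ‖s‖ ≤ ‖x‖ * m := ((div_lt_iff₀ hm).1 (not_le.1 hx)).le
      nlinarith [norm_nonneg x]
  refine ⟨a, fun x => ?_⟩
  -- compare both endpoints with the midpoint
  obtain ⟨s, hs⟩ := hsub ((1 / 2 : ℝ) • (a + x))
  have e1 : x - (1 / 2 : ℝ) • (a + x) = (1 / 2 : ℝ) • (x - a) := by module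
  have e2 : a - (1 / 2 : ℝ) • (a + x) = -((1 / 2 : ℝ) • (x - a)) := by module
  have h1 := hs x
  have h2 := hs a
  have h3 := hmin ((1 / 2 : ℝ) • (a + x))
  rw [e1] at h1
  rw [e2, inner_neg_right, norm_neg] at h2
  have h4 : ‖(1 / 2 : ℝ) • (x - a)‖ ^ 2 = ‖x - a‖ ^ 2 / 4 := by
    rw [norm_smul, mul_pow]; norm_num; ring
  rw [h4] at h1 h2
  linarith

variable {d₁ d₂ : ℕ} {f : Vec d₁ → Vec d₂ → ℝ} {l μ : ℝ}

namespace LipschitzSmooth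

lemma differentiable_left (hf : LipschitzSmooth f l) (y : Vec d₂) :
    Differentiable ℝ (fun x => f x y) :=
  hf.differentiable.comp (differentiable_id.prodMk (differentiable_const y))

lemma differentiable_right (hf : LipschitzSmooth f l) (x : Vec d₁) :
    Differentiable ℝ (f x) :=
  hf.differentiable.comp ((differentiable_const x).prodMk differentiable_id)

lemma abs_sub_left_le (hf : LipschitzSmooth f l) (x x' : Vec d₁) (y : Vec d₂) :
    |f x' y - f x y - inner ℝ (gradX f x y) (x' - x)| ≤ l / 2 * ‖x' - x‖ ^ 2 :=
  abs_sub_sub_inner_gradient_le (hf.differentiable_left y)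
    (fun a b => by simpa [gradX] using hf.lipschitz_x a b y y) x x'

lemma abs_sub_right_le (hf : LipschitzSmooth f l) (x : Vec d₁) (y y' : Vec d₂) :
    |f x y' - f x y - inner ℝ (gradY f x y) (y' - y)| ≤ l / 2 * ‖y' - y‖ ^ 2 :=
  abs_sub_sub_inner_gradient_le (hf.differentiable_right x)
    (fun a b => by simpa [gradY] using hf.lipschitz_y x x a b) y y'

end LipschitzSmooth

lemma PLInY.le_primal (hpl : PLInY f μ) (x : Vec d₁) (y : Vec d₂) : f x y ≤ primal f x := by
  obtain ⟨y₀, h⟩ := hpl.max_attained x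
  exact le_ciSup ⟨f x y₀, by rintro _ ⟨y', rfl⟩; exact h y'⟩ y

lemma PLInY.exists_primal_eq (hpl : PLInY f μ) (x : Vec d₁) : ∃ y, primal f x = f x y := by
  obtain ⟨y₀, h⟩ := hpl.max_attained x
  exact ⟨y₀, le_antisymm (ciSup_le h) (hpl.le_primal x y₀)⟩

/-! ### The proximal minimizers -/

/-- The gradient in `x` of the auxiliary function `f x y + l * ‖x - z‖ ^ 2`. -/
def proxGrad (f : Vec d₁ → Vec d₂ → ℝ) (l : ℝ) (x : Vec d₁) (y : Vec d₂) (z : Vec d₁) : Vec d₁ :=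
  gradX f x y + (2 * l) • (x - z)

/-- The minimizer in `x` of the auxiliary function `f x y + l * ‖x - z‖ ^ 2`, chosen together with
its quadratic growth property. It exists by `exists_forall_add_sq_le` when `f` is `l`-smooth; see
`proxArg_spec`. -/
def proxArg (f : Vec d₁ → Vec d₂ → ℝ) (l : ℝ) (y : Vec d₂) (z : Vec d₁) : Vec d₁ :=
  Classical.epsilon fun x => ∀ x',
    f x y + l * ‖x - z‖ ^ 2 + l / 4 * ‖x' - x‖ ^ 2 ≤ f x' y + l * ‖x' - z‖ ^ 2

/-- The minimizer in `x` of the regularized primal function `primal f x + l * ‖x - z‖ ^ 2`, chosen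
together with its quadratic growth property; see `primalProxArg_spec`. -/
def primalProxArg (f : Vec d₁ → Vec d₂ → ℝ) (l : ℝ) (z : Vec d₁) : Vec d₁ :=
  Classical.epsilon fun x => ∀ x',
    primal f x + l * ‖x - z‖ ^ 2 + l / 4 * ‖x' - x‖ ^ 2 ≤ primal f x' + l * ‖x' - z‖ ^ 2

lemma norm_sub_sq_expand {E : Type*} [NormedAddCommGroup E] [InnerProductSpace ℝ E] (x x' z : E) :
    ‖x' - z‖ ^ 2 = ‖x - z‖ ^ 2 + 2 * inner ℝ (x - z) (x' - x) + ‖x' - x‖ ^ 2 := by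
  rw [← sub_add_sub_cancel x' x z, add_comm, norm_add_sq_real]

lemma LipschitzSmooth.prox_lower (hf : LipschitzSmooth f l) (x x' : Vec d₁) (y : Vec d₂)
    (z : Vec d₁) :
    f x y + l * ‖x - z‖ ^ 2 + inner ℝ (proxGrad f l x y z) (x' - x) + l / 2 * ‖x' - x‖ ^ 2
      ≤ f x' y + l * ‖x' - z‖ ^ 2 := by
  have h := neg_le_of_abs_le (hf.abs_sub_left_le x x' y)
  rw [norm_sub_sq_expand x x' z, proxGrad, inner_add_left, real_inner_smul_left]
  linarith

lemma LipschitzSmooth.prox_upper (hf : LipschitzSmooth f l) (x x' : Vec d₁) (y : Vec d₂)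
    (z : Vec d₁) :
    f x' y + l * ‖x' - z‖ ^ 2 ≤
      f x y + l * ‖x - z‖ ^ 2 + inner ℝ (proxGrad f l x y z) (x' - x)
        + 3 * l / 2 * ‖x' - x‖ ^ 2 := by
  have h := le_of_abs_le (hf.abs_sub_left_le x x' y)
  rw [norm_sub_sq_expand x x' z, proxGrad, inner_add_left, real_inner_smul_left]
  linarith

lemma proxArg_spec (hf : LipschitzSmooth f l) (hl : 0 < l) (y : Vec d₂) (z x : Vec d₁) :
    f (proxArg f l y z) y + l * ‖proxArg f l y z - z‖ ^ 2 + l / 4 * ‖x - proxArg f l y z‖ ^ 2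
      ≤ f x y + l * ‖x - z‖ ^ 2 := by
  have hc : Continuous fun x => f x y + l * ‖x - z‖ ^ 2 := by
    have := (hf.differentiable_left y).continuous
    fun_prop
  exact Classical.epsilon_spec (exists_forall_add_sq_le hl hc.lowerSemicontinuous
    fun x => ⟨_, fun x' => hf.prox_lower x x' y z⟩) x

lemma primalProxArg_spec (hf : LipschitzSmooth f l) (hpl : PLInY f μ) (hl : 0 < l)
    (z x : Vec d₁) :
    primal f (primalProxArg f l z) + l * ‖primalProxArg f l z - z‖ ^ 2
        + l / 4 * ‖x - primalProxArg f l z‖ ^ 2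
      ≤ primal f x + l * ‖x - z‖ ^ 2 := by
  have hc : LowerSemicontinuous (primal f) := by
    refine lowerSemicontinuous_ciSup (f := fun y x => f x y) (fun x => ?_)
      fun y => (hf.differentiable_left y).continuous.lowerSemicontinuous
    exact ⟨primal f x, by rintro _ ⟨y, rfl⟩; exact hpl.le_primal x y⟩
  have hc' : LowerSemicontinuous fun x => primal f x + l * ‖x - z‖ ^ 2 :=
    hc.add (Continuous.lowerSemicontinuous (by fun_prop))
  refine Classical.epsilon_spec (exists_forall_add_sq_le hl hc' fun x => ?_) x
  -- a strong subgradient of the maximum is the gradient at a maximizer `y`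
  obtain ⟨y, hy⟩ := hpl.exists_primal_eq x
  refine ⟨proxGrad f l x y z, fun x' => ?_⟩
  rw [hy]
  exact (hf.prox_lower x x' y z).trans (by linarith [hpl.le_primal x' y])

lemma proxGrad_proxArg (hf : LipschitzSmooth f l) (hl : 0 < l) (y : Vec d₂) (z : Vec d₁) :
    proxGrad f l (proxArg f l y z) y z = 0 := by
  set x := proxArg f l y z
  set g := proxGrad f l x y z with hg
  -- a gradient step of length `1 / (3 l)` cannot decrease the function
  have h1 := hf.prox_upper x (x - (1 / (3 * l)) • g) y z
  have h2 := proxArg_spec hf hl y z (x - (1 / (3 * l)) • g)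
  rw [sub_sub_cancel_left, norm_neg, norm_smul, Real.norm_of_nonneg (by positivity), mul_pow] at h1
  rw [inner_neg_right, real_inner_smul_right, ← hg, real_inner_self_eq_norm_sq] at h1
  have h3 : 0 ≤ l / 4 * ‖x - (1 / (3 * l)) • g - x‖ ^ 2 := by positivity
  have h4 : 3 * l / 2 * ((1 / (3 * l)) ^ 2 * ‖g‖ ^ 2) = 1 / (6 * l) * ‖g‖ ^ 2 := by
    field_simp; ring
  have h5 : 1 / (3 * l) * ‖g‖ ^ 2 = 2 * (1 / (6 * l) * ‖g‖ ^ 2) := by field_simp; ring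
  have h6 : 1 / (6 * l) * ‖g‖ ^ 2 ≤ 0 := by linarith
  have h7 : ‖g‖ ^ 2 ≤ 0 := by
    by_contra h
    have : 0 < 1 / (6 * l) * ‖g‖ ^ 2 := mul_pos (by positivity) (not_le.1 h)
    linarith
  simpa using le_antisymm h7 (sq_nonneg _)

/-- Error bound: the distance to the minimizer is controlled by the gradient. -/
lemma norm_sub_proxArg_le (hf : LipschitzSmooth f l) (hl : 0 < l) (x : Vec d₁) (y : Vec d₂)
    (z : Vec d₁) : l * ‖x - proxArg f l y z‖ ≤ ‖proxGrad f l x y z‖ := by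
  set m := proxArg f l y z
  have h1 := hf.prox_lower x m y z
  have h2 := hf.prox_lower m x y z
  rw [proxGrad_proxArg hf hl, inner_zero_left] at h2
  have h3 := neg_le_of_abs_le (abs_real_inner_le_norm (proxGrad f l x y z) (m - x))
  rw [norm_sub_rev m x] at h1 h3
  by_contra! h
  have h4 : 0 < ‖x - m‖ := by
    by_contra h5
    have : ‖x - m‖ = 0 := le_antisymm (not_lt.1 h5) (norm_nonneg _)
    rw [this, mul_zero] at h
    exact absurd h (not_lt.2 (norm_nonneg _))
  nlinarith

lemma norm_proxArg_sub_le (hf : LipschitzSmooth f l) (hl : 0 < l) (y y' : Vec d₂)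
    (z z' : Vec d₁) :
    ‖proxArg f l y z - proxArg f l y' z'‖ ≤ ‖y - y'‖ + 2 * ‖z - z'‖ := by
  set x := proxArg f l y z with hx
  have h1 := norm_sub_proxArg_le hf hl x y' z'
  have h2 : proxGrad f l x y' z' = gradX f x y' - gradX f x y + (2 * l) • (z - z') := by
    have := proxGrad_proxArg hf hl y z
    rw [← hx] at this
    calc _ = proxGrad f l x y' z' - proxGrad f l x y z := by rw [this, sub_zero]
      _ = _ := by simp only [proxGrad]; module
  have h3 : ‖proxGrad f l x y' z'‖ ≤ l * ‖y - y'‖ + 2 * l * ‖z - z'‖ := by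
    rw [h2]
    refine (norm_add_le _ _).trans (add_le_add ?_ ?_)
    · have := hf.lipschitz_x x x y' y
      rwa [sub_self, norm_zero, zero_add, norm_sub_rev y' y] at this
    · rw [norm_smul, Real.norm_of_nonneg (by positivity)]
  refine le_of_mul_le_mul_left (h1.trans (h3.trans (le_of_eq ?_))) hl
  ring

/-- The PL inequality makes the minimizers of the auxiliary function and of the regularized primal
function close when `∇_y f` is small at the former: the value of the regularized primal function
at `proxArg f l y z` exceeds its minimum by at most the PL gap there, since
`f (proxArg f l y z) y + …` is a lower bound for that minimum. -/
lemma norm_proxArg_sub_primalProxArg_sq_le (hf : LipschitzSmooth f l) (hpl : PLInY f μ)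
    (hl : 0 < l) (hμ : 0 < μ) (y : Vec d₂) (z : Vec d₁) :
    l * μ * ‖proxArg f l y z - primalProxArg f l z‖ ^ 2
      ≤ ‖gradY f (proxArg f l y z) y‖ ^ 2 := by
  have h1 := primalProxArg_spec hf hpl hl z (proxArg f l y z)
  have h2 := proxArg_spec hf hl y z (primalProxArg f l z)
  have h3 := hpl.le_primal (primalProxArg f l z) y
  have h4 := hpl.pl (proxArg f l y z) y
  rw [norm_sub_rev (primalProxArg f l z)] at h2
  have h6 : l / 2 * ‖proxArg f l y z - primalProxArg f l z‖ ^ 2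
      ≤ primal f (proxArg f l y z) - f (proxArg f l y z) y := by linarith
  have h7 := mul_le_mul_of_nonneg_left h6 (show 0 ≤ 2 * μ by positivity)
  nlinarith

end SmoothedAGDA

namespace SmoothedAGDA

/-! ### The potential function and its one-step decrease -/

variable {d₁ d₂ : ℕ} {f : Vec d₁ → Vec d₂ → ℝ} {l μ : ℝ}

/-- The potential `V = f̂(x, y; z) - 2 Ψ(y; z) + 2 P(z)`, where `f̂(x, y; z) = f(x, y) + l ‖x - z‖²`,
`Ψ(y; z) = min_x f̂(x, y; z)` and `P(z) = min_x max_y f̂(x, y; z)`. -/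
def potential (f : Vec d₁ → Vec d₂ → ℝ) (l : ℝ) (x : Vec d₁) (y : Vec d₂) (z : Vec d₁) : ℝ :=
  (f x y + l * ‖x - z‖ ^ 2)
    - 2 * (f (proxArg f l y z) y + l * ‖proxArg f l y z - z‖ ^ 2)
    + 2 * (primal f (primalProxArg f l z) + l * ‖primalProxArg f l z - z‖ ^ 2)

/-- The potential is the sum of the nonnegative gaps `f̂ - Ψ` and `P - Ψ` and of `P`, which is at
least the infimum of the primal function. -/
lemma le_potential (hf : LipschitzSmooth f l) (hpl : PLInY f μ) (hl : 0 < l) {c : ℝ}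
    (hc : ∀ x, c ≤ primal f x) (x : Vec d₁) (y : Vec d₂) (z : Vec d₁) : c ≤ potential f l x y z := by
  have h1 := proxArg_spec hf hl y z x
  have h2 := proxArg_spec hf hl y z (primalProxArg f l z)
  have h3 := hpl.le_primal (primalProxArg f l z) y
  have h4 := hc (primalProxArg f l z)
  have h5 : 0 ≤ l / 4 * ‖x - proxArg f l y z‖ ^ 2 := by positivity
  have h6 : 0 ≤ l / 4 * ‖primalProxArg f l z - proxArg f l y z‖ ^ 2 := by positivity
  have h7 : 0 ≤ l * ‖primalProxArg f l z - z‖ ^ 2 := by positivity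
  unfold potential
  linarith

/-- The primal-dual gap of the auxiliary function, with the minimum over `x` and the maximum over
`y` evaluated. -/
lemma gap_aux_eq (hf : LipschitzSmooth f l) (hpl : PLInY f μ) (hl : 0 < l)
    (x : Vec d₁) (y : Vec d₂) (z : Vec d₁) :
    gap (aux f (2 * l) z) x y = (primal f x + l * ‖x - z‖ ^ 2)
      - (f (proxArg f l y z) y + l * ‖proxArg f l y z - z‖ ^ 2) := by
  have hp : 2 * l / 2 = l := by ring
  unfold gap aux
  rw [hp]
  congr 1
  · rw [primal, ciSup_add]
    exact ⟨primal f x, by rintro _ ⟨y', rfl⟩; exact hpl.le_primal x y'⟩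
  · have h : ∀ x', f (proxArg f l y z) y + l * ‖proxArg f l y z - z‖ ^ 2
        ≤ f x' y + l * ‖x' - z‖ ^ 2 := fun x' => by
      have h1 := proxArg_spec hf hl y z x'
      have h2 : 0 ≤ l / 4 * ‖x' - proxArg f l y z‖ ^ 2 := by positivity
      linarith
    refine le_antisymm (ciInf_le
      ⟨f (proxArg f l y z) y + l * ‖proxArg f l y z - z‖ ^ 2, ?_⟩ (proxArg f l y z)) (le_ciInf h)
    rintro _ ⟨x', rfl⟩
    exact h x'

lemma gap_aux_nonneg (hf : LipschitzSmooth f l) (hpl : PLInY f μ) (hl : 0 < l)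
    (x : Vec d₁) (y : Vec d₂) (z : Vec d₁) : 0 ≤ gap (aux f (2 * l) z) x y := by
  rw [gap_aux_eq hf hpl hl]
  have h1 := proxArg_spec hf hl y z x
  have h2 : 0 ≤ l / 4 * ‖x - proxArg f l y z‖ ^ 2 := by positivity
  linarith [hpl.le_primal x y]

lemma potential_le (hf : LipschitzSmooth f l) (hpl : PLInY f μ) (hl : 0 < l)
    (x : Vec d₁) (y : Vec d₂) (z : Vec d₁) :
    potential f l x y z ≤ primal f z + 2 * gap (aux f (2 * l) z) x y := by
  rw [gap_aux_eq hf hpl hl]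
  have h1 := hpl.le_primal x y
  have h2 := primalProxArg_spec hf hpl hl z x
  have h3 := primalProxArg_spec hf hpl hl z z
  have h5 : 0 ≤ l / 4 * ‖x - primalProxArg f l z‖ ^ 2 := by positivity
  have h6 : 0 ≤ l / 4 * ‖z - primalProxArg f l z‖ ^ 2 := by positivity
  have h7 : l * ‖z - z‖ ^ 2 = 0 := by simp
  unfold potential
  linarith

/-- Descent of the auxiliary function under a stochastic gradient step in `x` with noise `u`. -/
lemma prox_step_x_le (hf : LipschitzSmooth f l) {τ : ℝ} (hτ : 0 ≤ τ) (hτl : 3 * l * τ ≤ 1)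
    (x : Vec d₁) (y : Vec d₂) (z u : Vec d₁) {x' : Vec d₁}
    (hx' : x' = x - τ • (proxGrad f l x y z + u)) :
    f x' y + l * ‖x' - z‖ ^ 2 ≤ f x y + l * ‖x - z‖ ^ 2 - τ / 2 * ‖proxGrad f l x y z‖ ^ 2
      - τ * (1 - 3 * l * τ) * inner ℝ (proxGrad f l x y z) u + 3 / 2 * l * τ ^ 2 * ‖u‖ ^ 2 := by
  have h := hf.prox_upper x x' y z
  set g := proxGrad f l x y z
  rw [hx', sub_sub_cancel_left, norm_neg, norm_smul, inner_neg_right, real_inner_smul_right,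
    inner_add_right, real_inner_self_eq_norm_sq, Real.norm_of_nonneg hτ, mul_pow,
    norm_add_sq_real, ← hx'] at h
  have h2 : 0 ≤ τ * (1 - 3 * l * τ) * ‖g‖ ^ 2 :=
    mul_nonneg (mul_nonneg hτ (by linarith)) (sq_nonneg _)
  linarith

/-- Change of `f(x, ·) - 2 Ψ(·; z)` under a stochastic ascent step in `y` with noise `v`. The
difference `‖h - q‖` of the gradient used and the gradient `q` of `Ψ` enters as an error. -/
lemma prox_step_y_le (hf : LipschitzSmooth f l) (hl : 0 < l) {τ : ℝ}
    (x' : Vec d₁) (y v : Vec d₂) (z : Vec d₁) {y' h q : Vec d₂} (hh : h = gradY f x' y)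
    (hq : q = gradY f (proxArg f l y z) y) (hy' : y' = y + τ • (h + v)) :
    f x' y' - 2 * (f (proxArg f l y' z) y' + l * ‖proxArg f l y' z - z‖ ^ 2)
      ≤ f x' y - 2 * (f (proxArg f l y z) y + l * ‖proxArg f l y z - z‖ ^ 2)
        + τ * ‖h - q‖ ^ 2 - τ * ‖q‖ ^ 2 + τ * inner ℝ (h - (2 : ℝ) • q) v
        + 7 / 2 * l * τ ^ 2 * ‖h + v‖ ^ 2 := by
  set m := proxArg f l y z with hm
  set m' := proxArg f l y' z with hm'
  have hyy : y' - y = τ • (h + v) := by rw [hy', add_sub_cancel_left]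
  have h1 := le_of_abs_le (hf.abs_sub_right_le x' y y')
  have h2 := neg_le_of_abs_le (hf.abs_sub_right_le m' y y')
  have h3 := proxArg_spec hf hl y z m'
  have h3' : 0 ≤ l / 4 * ‖m' - m‖ ^ 2 := by positivity
  -- replace the minimizer at `y'` by the one at `y` in the linear term
  have h4 : inner ℝ q (y' - y) - l * ‖y' - y‖ ^ 2 ≤ inner ℝ (gradY f m' y) (y' - y) := by
    have a1 := neg_le_of_abs_le (abs_real_inner_le_norm (gradY f m' y - q) (y' - y))
    have a2 : ‖gradY f m' y - q‖ ≤ l * ‖y' - y‖ := by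
      have b1 := hf.lipschitz_y m' m y y
      have b2 := norm_proxArg_sub_le hf hl y' y z z
      rw [sub_self, norm_zero, add_zero] at b1
      rw [sub_self z, norm_zero, mul_zero, add_zero] at b2
      rw [hq]
      exact b1.trans (mul_le_mul_of_nonneg_left b2 hl.le)
    have a3 := mul_le_mul_of_nonneg_right a2 (norm_nonneg (y' - y))
    rw [inner_sub_left] at a1
    linarith
  rw [← hh] at h1
  have e1 : ‖y' - y‖ ^ 2 = τ ^ 2 * ‖h + v‖ ^ 2 := by
    rw [hyy, norm_smul, mul_pow, Real.norm_eq_abs, sq_abs]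
  have e2 : inner ℝ h (y' - y) - 2 * inner ℝ q (y' - y)
      = τ * ‖h - q‖ ^ 2 - τ * ‖q‖ ^ 2 + τ * inner ℝ (h - (2 : ℝ) • q) v := by
    rw [hyy, real_inner_smul_right, real_inner_smul_right, inner_add_right, inner_add_right,
      inner_sub_left, real_inner_smul_left, norm_sub_sq_real, real_inner_self_eq_norm_sq,
      real_inner_comm h q]
    ring
  rw [e1] at h1 h2 h4
  linarith

/-- Change of the potential when the proximal center moves from `z` to `z + β (x - z)`. -/
lemma potential_step_z_le (hf : LipschitzSmooth f l) (hpl : PLInY f μ) (hl : 0 < l) {β : ℝ}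
    (hβ : 0 ≤ β) (hβ1 : β ≤ 1) (x : Vec d₁) (y : Vec d₂) (z : Vec d₁) {z' : Vec d₁}
    (hz' : z' = z + β • (x - z)) :
    potential f l x y z' ≤ potential f l x y z - l * β * ‖x - z‖ ^ 2
      + 4 * l * β * (‖x - z‖ * ‖proxArg f l y z' - primalProxArg f l z‖) := by
  set m := proxArg f l y z' with hm
  set P := primalProxArg f l z
  have h1 := proxArg_spec hf hl y z m
  have h2 := primalProxArg_spec hf hpl hl z' P
  have h1' : 0 ≤ l / 4 * ‖m - proxArg f l y z‖ ^ 2 := by positivity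
  have h2' : 0 ≤ l / 4 * ‖P - primalProxArg f l z'‖ ^ 2 := by positivity
  have e1 : ‖x - z'‖ ^ 2 = (1 - β) ^ 2 * ‖x - z‖ ^ 2 := by
    have : x - z' = (1 - β) • (x - z) := by rw [hz']; module
    rw [this, norm_smul, mul_pow, Real.norm_eq_abs, sq_abs]
  have e2 : (1 - β) ^ 2 * ‖x - z‖ ^ 2 ≤ ‖x - z‖ ^ 2 - β * ‖x - z‖ ^ 2 := by
    nlinarith [sq_nonneg ‖x - z‖, mul_nonneg (mul_nonneg hβ (sub_nonneg.2 hβ1))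
      (sq_nonneg ‖x - z‖)]
  have e3 : ∀ a : Vec d₁, ‖a - z'‖ ^ 2 - ‖a - z‖ ^ 2
      = β ^ 2 * ‖x - z‖ ^ 2 - 2 * β * inner ℝ (x - z) (a - z) := fun a => by
    have : a - z' = (a - z) - β • (x - z) := by rw [hz']; module
    rw [this, norm_sub_sq_real, norm_smul, mul_pow, Real.norm_eq_abs, sq_abs,
      real_inner_smul_right, real_inner_comm]
    ring
  have e4 := e3 m
  have e5 := e3 P
  have e6 : inner ℝ (x - z) (m - z) - inner ℝ (x - z) (P - z) = inner ℝ (x - z) (m - P) := by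
    rw [← inner_sub_right, sub_sub_sub_cancel_right]
  have e7 := real_inner_le_norm (x - z) (m - P)
  have e8 : 2 * (l * ‖P - z'‖ ^ 2 - l * ‖P - z‖ ^ 2) - 2 * (l * ‖m - z'‖ ^ 2 - l * ‖m - z‖ ^ 2)
      = 4 * l * β * inner ℝ (x - z) (m - P) := by
    rw [← e6]; linear_combination (2 * l) * e5 - (2 * l) * e4
  have e9 := mul_le_mul_of_nonneg_left e7 (show 0 ≤ 4 * l * β by positivity)
  have e10 := mul_le_mul_of_nonneg_left (e1.le.trans e2) hl.le
  unfold potential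
  linarith

/-- The scalar inequality that combines the one-step estimates: with the step sizes of the
algorithm, all error terms are absorbed by the negative ones. -/
lemma absorb_errors {l μ s τ β G U A H W v a e : ℝ} (hl : 0 < l) (hμ : 0 < μ) (hμl : μ ≤ l)
    (hs : 0 < s) (hτ : τ = 48 * s) (hsl : 144 * l * s ≤ 1) (hβ : β = s * μ / 1600)
    (hH0 : 0 ≤ H) (hH : H ≤ 4 / 3 * G + l * τ * U)
    (hW : W ^ 2 ≤ 4 * A ^ 2 + 4 * H ^ 2 + 2 * v ^ 2)
    (he : l * μ * e ^ 2 ≤ A ^ 2) :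
    -(τ / 2 * G ^ 2) + 3 / 2 * l * τ ^ 2 * U ^ 2 + s * H ^ 2 - s * A ^ 2
        + 7 / 2 * l * s ^ 2 * W ^ 2 - l * β * a ^ 2 + 4 * l * β * (a * (2 * β * a + s * W + e))
      ≤ -(20 * s * G ^ 2) - 4 / 5 * s * A ^ 2 - 2 / 5 * (l * β) * a ^ 2
        + 19 / 10 * l * τ ^ 2 * (U ^ 2 + v ^ 2) := by
  have hls : l * s ≤ 1 / 144 := by linarith
  have hμs : s * μ ≤ 1 / 144 := by nlinarith
  have hβ0 : 0 < β := by rw [hβ]; positivity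
  have hβ1 : β ≤ 1 / 230400 := by rw [hβ]; linarith
  have hlβ : 0 < l * β := by positivity
  have i1 : l * β * (8 * β * a ^ 2) ≤ l * β * (1 / 20 * a ^ 2) := by
    gcongr
    linarith
  have i2 : l * β * (4 * (a * (s * W))) ≤ l * β * (1 / 4 * a ^ 2 + 16 * (s * W) ^ 2) := by
    gcongr
    nlinarith [sq_nonneg (1 / 2 * a - 4 * (s * W))]
  have i3 : l * β * (4 * (a * e)) ≤ l * β * (1 / 4 * a ^ 2 + 16 * e ^ 2) := by
    gcongr
    nlinarith [sq_nonneg (1 / 2 * a - 4 * e)]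
  have i4 : l * β * (16 * e ^ 2) ≤ s / 100 * A ^ 2 := by
    have : l * β * (16 * e ^ 2) = s / 100 * (l * μ * e ^ 2) := by rw [hβ]; ring
    rw [this]
    gcongr
  have i5 : l * β * (16 * (s * W) ^ 2) ≤ 1 / 10 * (l * s ^ 2 * W ^ 2) := by
    have : l * β * (16 * (s * W) ^ 2) = 16 * β * (l * s ^ 2 * W ^ 2) := by ring
    rw [this]
    gcongr
    linarith
  have i6 : l * s ^ 2 * W ^ 2 ≤ l * s ^ 2 * (4 * A ^ 2 + 4 * H ^ 2 + 2 * v ^ 2) := by gcongr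
  have i7 : l * s ^ 2 * (4 * A ^ 2 + 4 * H ^ 2) ≤ 1 / 144 * (s * (4 * A ^ 2 + 4 * H ^ 2)) := by
    have : l * s ^ 2 * (4 * A ^ 2 + 4 * H ^ 2) = l * s * (s * (4 * A ^ 2 + 4 * H ^ 2)) := by ring
    rw [this]
    gcongr
  have i8 : H ^ 2 ≤ 32 / 9 * G ^ 2 + 2 * (l * τ * U) ^ 2 := by
    have := pow_le_pow_left₀ hH0 hH 2
    nlinarith [sq_nonneg (4 / 3 * G - l * τ * U)]
  have i9 : s * H ^ 2 ≤ s * (32 / 9 * G ^ 2 + 2 * (l * τ * U) ^ 2) := by gcongr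
  have i10 : s * (2 * (l * τ * U) ^ 2) ≤ 1 / 72 * (l * τ ^ 2 * U ^ 2) := by
    have : s * (2 * (l * τ * U) ^ 2) = 2 * (l * s) * (l * τ ^ 2 * U ^ 2) := by ring
    rw [this]
    gcongr
    linarith
  have i11 : l * s ^ 2 * v ^ 2 = 1 / 2304 * (l * τ ^ 2 * v ^ 2) := by rw [hτ]; ring
  have p1 : 0 ≤ l * τ ^ 2 * U ^ 2 := by positivity
  have p2 : 0 ≤ l * τ ^ 2 * v ^ 2 := by positivity
  have p3 : 0 ≤ s * G ^ 2 := by positivity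
  have p4 : 0 ≤ s * A ^ 2 := by positivity
  have p5 : 0 ≤ s * H ^ 2 := by positivity
  have p6 : 0 ≤ l * β * a ^ 2 := by positivity
  have e1 : τ / 2 * G ^ 2 = 24 * (s * G ^ 2) := by rw [hτ]; ring
  rw [e1]
  linarith

/-- The squared gradients of `f` at an iterate, in terms of the negative terms in the one-step
estimate of the potential. -/
lemma sq_add_sq_le_of_decrease {l μ s τ β G U A a n X Y : ℝ} (hl : 0 < l) (hμ : 0 < μ)
    (hμl : μ ≤ l) (hs : 0 < s) (hτ : τ = 48 * s) (hsl : 144 * l * s ≤ 1) (hβ : β = s * μ / 1600)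
    (hn0 : 0 ≤ n) (hn : n ≤ a + τ * G + τ * U) (hX0 : 0 ≤ X)
    (hX : X ≤ G + 2 * l * n) (hY0 : 0 ≤ Y) (hY : Y ≤ A + G) :
    s * (μ * X ^ 2 + l * Y ^ 2) ≤
      160000 * l * (20 * s * G ^ 2 + 4 / 5 * s * A ^ 2 + 2 / 5 * (l * β) * a ^ 2
        + 1 / 10 * l * τ ^ 2 * U ^ 2) := by
  have hlτ : l * τ ≤ 1 / 3 := by rw [hτ]; linarith
  have hlτ0 : 0 ≤ l * τ := by rw [hτ]; positivity
  have i1 : X ^ 2 ≤ 2 * G ^ 2 + 8 * (l * n) ^ 2 := by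
    have := pow_le_pow_left₀ hX0 hX 2
    nlinarith [sq_nonneg (G - 2 * (l * n))]
  have i2 : Y ^ 2 ≤ 2 * A ^ 2 + 2 * G ^ 2 := by
    have := pow_le_pow_left₀ hY0 hY 2
    nlinarith [sq_nonneg (A - G)]
  have i3 : (l * n) ^ 2 ≤ 3 * (l * a) ^ 2 + 3 * (l * τ * G) ^ 2 + 3 * (l * τ * U) ^ 2 := by
    have h : l * n ≤ l * a + l * τ * G + l * τ * U := by
      have := mul_le_mul_of_nonneg_left hn hl.le
      linarith
    have := pow_le_pow_left₀ (by positivity) h 2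
    nlinarith [sq_nonneg (l * a - l * τ * G), sq_nonneg (l * a - l * τ * U),
      sq_nonneg (l * τ * G - l * τ * U)]
  have i4 : (l * τ * G) ^ 2 ≤ 1 / 9 * G ^ 2 := by
    rw [mul_pow]
    gcongr
    nlinarith
  have i5 : X ^ 2 ≤ 5 * G ^ 2 + 24 * (l * a) ^ 2 + 24 * (l * τ * U) ^ 2 := by
    linarith [sq_nonneg G]
  have i6 : μ * (s * X ^ 2) ≤ μ * (s * (5 * G ^ 2 + 24 * (l * a) ^ 2 + 24 * (l * τ * U) ^ 2)) := by
    gcongr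
  have i7 : l * (s * Y ^ 2) ≤ l * (s * (2 * A ^ 2 + 2 * G ^ 2)) := by gcongr
  have i8 : μ * (s * (5 * G ^ 2)) ≤ l * (s * (5 * G ^ 2)) := by gcongr
  have i9 : μ * (s * (24 * (l * τ * U) ^ 2)) ≤ l * (1 / 6 * (l * τ ^ 2 * U ^ 2)) := by
    have : s * (24 * (l * τ * U) ^ 2) = (24 * l * s) * (l * τ ^ 2 * U ^ 2) := by ring
    rw [this]
    gcongr
    linarith
  -- this term dictates the size of the constant, through the denominator `1600` of `β`
  have i10 : μ * (s * (24 * (l * a) ^ 2)) = l * (38400 * (l * β * a ^ 2)) := by rw [hβ]; ring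
  have p1 : 0 ≤ l * (l * τ ^ 2 * U ^ 2) := by positivity
  have p3 : 0 ≤ l * (s * G ^ 2) := by positivity
  have p4 : 0 ≤ l * (s * A ^ 2) := by positivity
  have p6 : 0 ≤ l * (l * β * a ^ 2) := by rw [hβ]; positivity
  linarith

/-- One iteration of the algorithm with noises `u` and `v`: up to two terms linear in the noise
(which have mean zero) and terms quadratic in the noise, the decrease of the potential controls
the stationarity measure. The inequality is pathwise. -/
theorem stationarity_le_potential_decrease (hf : LipschitzSmooth f l) (hpl : PLInY f μ)
    (hμ : 0 < μ) (hμl : μ ≤ l) {τ₁ τ₂ β : ℝ} (hτ₂ : 0 < τ₂) (hτ : τ₁ = 48 * τ₂)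
    (hτl : 144 * l * τ₂ ≤ 1) (hβ : β = τ₂ * μ / 1600)
    (x z u : Vec d₁) (y v : Vec d₂) {x' z' : Vec d₁} {y' : Vec d₂}
    (hx' : x' = x - τ₁ • (proxGrad f l x y z + u))
    (hy' : y' = y + τ₂ • (gradY f x' y + v)) (hz' : z' = z + β • (x' - z)) :
    τ₂ * (μ * ‖gradX f x y‖ ^ 2 + l * ‖gradY f x y‖ ^ 2) ≤
      160000 * l * (potential f l x y z - potential f l x' y' z'
        - τ₁ * (1 - 3 * l * τ₁) * inner ℝ (proxGrad f l x y z) u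
        + τ₂ * inner ℝ (gradY f x' y - (2 : ℝ) • gradY f (proxArg f l y z) y) v
        + 2 * l * τ₁ ^ 2 * (‖u‖ ^ 2 + ‖v‖ ^ 2)) := by
  have hl : 0 < l := hμ.trans_le hμl
  have hτ₁ : 0 < τ₁ := by rw [hτ]; positivity
  set g := proxGrad f l x y z with hg
  set m := proxArg f l y z with hm
  set q := gradY f m y with hq
  set h := gradY f x' y with hh
  have hβ0 : 0 ≤ β := by rw [hβ]; positivity
  have hμs : τ₂ * μ ≤ 1 / 144 := by nlinarith
  have hβ1 : β ≤ 1 := by rw [hβ]; linarith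
  have s1 := prox_step_x_le hf hτ₁.le (by rw [hτ]; linarith) x y z u hx'
  have s2 := prox_step_y_le hf hl x' y v z hh hq hy'
  have s3 := potential_step_z_le hf hpl hl hβ0 hβ1 x' y' z hz'
  have hxm : l * ‖x - m‖ ≤ ‖g‖ := norm_sub_proxArg_le hf hl x y z
  have hxx : ‖x' - x‖ ≤ τ₁ * ‖g‖ + τ₁ * ‖u‖ := by
    rw [hx', sub_sub_cancel_left, norm_neg, norm_smul, Real.norm_of_nonneg hτ₁.le, ← mul_add]
    exact mul_le_mul_of_nonneg_left (norm_add_le _ _) hτ₁.le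
  have hH : ‖h - q‖ ≤ 4 / 3 * ‖g‖ + l * τ₁ * ‖u‖ := by
    have a1 := hf.lipschitz_y x' m y y
    rw [sub_self, norm_zero, add_zero] at a1
    have a2 := norm_sub_le_norm_sub_add_norm_sub x' x m
    have a3 := mul_le_mul_of_nonneg_left (a2.trans (add_le_add_left hxx _)) hl.le
    have a4 : l * τ₁ * ‖g‖ ≤ 1 / 3 * ‖g‖ :=
      mul_le_mul_of_nonneg_right (by rw [hτ]; linarith) (norm_nonneg _)
    linarith
  have hW : ‖h + v‖ ^ 2 ≤ 4 * ‖q‖ ^ 2 + 4 * ‖h - q‖ ^ 2 + 2 * ‖v‖ ^ 2 := by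
    have a1 : ‖h + v‖ ≤ ‖q‖ + ‖h - q‖ + ‖v‖ := by
      have := norm_add₃_le (a := q) (b := h - q) (c := v)
      rwa [add_sub_cancel] at this
    have a2 := pow_le_pow_left₀ (norm_nonneg _) a1 2
    nlinarith [sq_nonneg (‖q‖ + ‖h - q‖ - ‖v‖), sq_nonneg (‖q‖ - ‖h - q‖)]
  have he := norm_proxArg_sub_primalProxArg_sq_le hf hpl hl hμ y z
  have hP : ‖proxArg f l y' z' - primalProxArg f l z‖
      ≤ 2 * β * ‖x' - z‖ + τ₂ * ‖h + v‖ + ‖m - primalProxArg f l z‖ := by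
    have a1 := norm_sub_le_norm_sub_add_norm_sub (proxArg f l y' z') m (primalProxArg f l z)
    have a2 := norm_proxArg_sub_le hf hl y' y z' z
    have a3 : ‖y' - y‖ = τ₂ * ‖h + v‖ := by
      rw [hy', add_sub_cancel_left, norm_smul, Real.norm_of_nonneg hτ₂.le]
    have a4 : ‖z' - z‖ = β * ‖x' - z‖ := by
      rw [hz', add_sub_cancel_left, norm_smul, Real.norm_of_nonneg hβ0]
    rw [a3, a4] at a2
    linarith
  have hP' := mul_le_mul_of_nonneg_left (mul_le_mul_of_nonneg_left hP (norm_nonneg (x' - z)))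
    (show 0 ≤ 4 * l * β by positivity)
  have hA := absorb_errors (a := ‖x' - z‖) hl hμ hμl hτ₂ hτ hτl hβ (norm_nonneg _) hH hW he
  have hn : ‖x - z‖ ≤ ‖x' - z‖ + τ₁ * ‖g‖ + τ₁ * ‖u‖ := by
    have := norm_sub_le_norm_sub_add_norm_sub x x' z
    rw [norm_sub_rev x x'] at this
    linarith
  have hX : ‖gradX f x y‖ ≤ ‖g‖ + 2 * l * ‖x - z‖ := by
    have : gradX f x y = g - (2 * l) • (x - z) := by rw [hg, proxGrad, add_sub_cancel_right]
    rw [this]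
    refine (norm_sub_le _ _).trans (le_of_eq ?_)
    rw [norm_smul, Real.norm_of_nonneg (by positivity)]
  have hY : ‖gradY f x y‖ ≤ ‖q‖ + ‖g‖ := by
    have a1 := hf.lipschitz_y x m y y
    rw [sub_self, norm_zero, add_zero] at a1
    have a2 := norm_le_norm_add_norm_sub' (gradY f x y) q
    linarith
  have hS := sq_add_sq_le_of_decrease hl hμ hμl hτ₂ hτ hτl hβ (norm_nonneg _) hn (norm_nonneg _)
    hX (norm_nonneg _) hY
  refine hS.trans (mul_le_mul_of_nonneg_left ?_ (by positivity))
  have e1 : potential f l x y z = (f x y + l * ‖x - z‖ ^ 2)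
    - 2 * (f m y + l * ‖m - z‖ ^ 2)
    + 2 * (primal f (primalProxArg f l z) + l * ‖primalProxArg f l z - z‖ ^ 2) := rfl
  have e2 : potential f l x' y' z = (f x' y' + l * ‖x' - z‖ ^ 2)
    - 2 * (f (proxArg f l y' z) y' + l * ‖proxArg f l y' z - z‖ ^ 2)
    + 2 * (primal f (primalProxArg f l z) + l * ‖primalProxArg f l z - z‖ ^ 2) := rfl
  have p2 : 0 ≤ l * τ₁ ^ 2 * ‖v‖ ^ 2 := by positivity
  linarith

end SmoothedAGDA

namespace SmoothedAGDA

/-! ### Stochastic gradients evaluated at independent random points -/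

variable {d₁ d₂ d : ℕ} {Ω Ξ S : Type*}

section Noise

variable [MeasurableSpace Ω] [MeasurableSpace Ξ] [MeasurableSpace S] {P : Measure Ω}
  {D : Measure Ξ} {G : Vec d₁ → Vec d₂ → Ξ → Vec d}
  {g : Vec d₁ → Vec d₂ → Vec d} {σ : ℝ} {X : Ω → S} {ζ : Ω → Ξ} {a : S → Vec d₁} {b : S → Vec d₂}

lemma StochasticGradient.measurable_noise (hG : StochasticGradient D G g σ)
    (hg : Measurable fun q : Vec d₁ × Vec d₂ => g q.1 q.2) (ha : Measurable a)
    (hb : Measurable b) :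
    Measurable fun r : S × Ξ => G (a r.1) (b r.1) r.2 - g (a r.1) (b r.1) :=
  (hG.measurable.comp ((ha.comp measurable_fst).prodMk
    ((hb.comp measurable_fst).prodMk measurable_snd))).sub
    (hg.comp ((ha.comp measurable_fst).prodMk (hb.comp measurable_fst)))

/-- The noise at a random point that is independent of the sample is square integrable, with
second moment at most `σ ^ 2`. -/
lemma StochasticGradient.memLp_noise [IsProbabilityMeasure P] [IsProbabilityMeasure D]
    (hG : StochasticGradient D G g σ)
    (hg : Measurable fun q : Vec d₁ × Vec d₂ => g q.1 q.2) (ha : Measurable a)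
    (hb : Measurable b) (hX : Measurable X) (hζ : Measurable ζ) (hlaw : P.map ζ = D)
    (hind : IndepFun X ζ P) :
    MemLp (fun ω => G (a (X ω)) (b (X ω)) (ζ ω) - g (a (X ω)) (b (X ω))) 2 P ∧
      ∫ ω, ‖G (a (X ω)) (b (X ω)) (ζ ω) - g (a (X ω)) (b (X ω))‖ ^ 2 ∂P ≤ σ ^ 2 := by
  have hN := hG.measurable_noise hg ha hb
  have hpair : Measurable fun ω => (X ω, ζ ω) := hX.prodMk hζ
  have hmap : P.map (fun ω => (X ω, ζ ω)) = (P.map X).prod D := by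
    rw [← hlaw]
    exact (indepFun_iff_map_prod_eq_prod_map_map hX.aemeasurable hζ.aemeasurable).1 hind
  have : IsProbabilityMeasure (P.map X) := Measure.isProbabilityMeasure_map hX.aemeasurable
  have hNsq : Measurable fun r : S × Ξ => ‖G (a r.1) (b r.1) r.2 - g (a r.1) (b r.1)‖ ^ 2 :=
    hN.norm.pow_const 2
  have hinner : Integrable (fun s => ∫ e, ‖G (a s) (b s) e - g (a s) (b s)‖ ^ 2 ∂D) (P.map X) := by
    have hm : StronglyMeasurable
        fun s => ∫ e, ‖G (a s) (b s) e - g (a s) (b s)‖ ^ 2 ∂D :=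
      hNsq.stronglyMeasurable.integral_prod_right'
    refine (integrable_const (σ ^ 2)).mono' hm.aestronglyMeasurable (.of_forall fun s => ?_)
    rw [Real.norm_of_nonneg (integral_nonneg fun _ => sq_nonneg _)]
    exact hG.variance_le (a s) (b s)
  have hint : Integrable (fun r : S × Ξ => ‖G (a r.1) (b r.1) r.2 - g (a r.1) (b r.1)‖ ^ 2)
      ((P.map X).prod D) := by
    refine (integrable_prod_iff hNsq.aestronglyMeasurable).2
      ⟨.of_forall fun s => hG.integrable_sq (a s) (b s), ?_⟩
    simpa only [norm_pow, norm_norm] using hinner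
  have hintΩ : Integrable (fun ω => ‖G (a (X ω)) (b (X ω)) (ζ ω) - g (a (X ω)) (b (X ω))‖ ^ 2) P :=
    (integrable_map_measure hNsq.aestronglyMeasurable hpair.aemeasurable).1 (hmap ▸ hint)
  refine ⟨(memLp_two_iff_integrable_sq_norm (hN.comp hpair).aestronglyMeasurable).2 hintΩ, ?_⟩
  have h1 := integral_map (μ := P) hpair.aemeasurable hNsq.aestronglyMeasurable
  rw [← h1, hmap, integral_prod _ hint]
  calc _ ≤ ∫ _, σ ^ 2 ∂(P.map X) :=
        integral_mono hinner (integrable_const _) fun s => hG.variance_le (a s) (b s)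
    _ = σ ^ 2 := by simp

/-- The noise is orthogonal to every square integrable function of the random point. -/
lemma StochasticGradient.integral_inner_noise [IsProbabilityMeasure P] [IsProbabilityMeasure D]
    (hG : StochasticGradient D G g σ)
    (hg : Measurable fun q : Vec d₁ × Vec d₂ => g q.1 q.2) (ha : Measurable a)
    (hb : Measurable b) (hX : Measurable X) (hζ : Measurable ζ) (hlaw : P.map ζ = D)
    (hind : IndepFun X ζ P) {c : S → Vec d} (hc : Measurable c)
    (hcX : MemLp (fun ω => c (X ω)) 2 P) :
    Integrable (fun ω => inner ℝ (c (X ω))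
        (G (a (X ω)) (b (X ω)) (ζ ω) - g (a (X ω)) (b (X ω)))) P ∧
      ∫ ω, inner ℝ (c (X ω)) (G (a (X ω)) (b (X ω)) (ζ ω) - g (a (X ω)) (b (X ω))) ∂P = 0 := by
  have hN := hG.measurable_noise hg ha hb
  have hpair : Measurable fun ω => (X ω, ζ ω) := hX.prodMk hζ
  have hmap : P.map (fun ω => (X ω, ζ ω)) = (P.map X).prod D := by
    rw [← hlaw]
    exact (indepFun_iff_map_prod_eq_prod_map_map hX.aemeasurable hζ.aemeasurable).1 hind
  have : IsProbabilityMeasure (P.map X) := Measure.isProbabilityMeasure_map hX.aemeasurable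
  have hF : Measurable fun r : S × Ξ =>
      (inner ℝ (c r.1) (G (a r.1) (b r.1) r.2 - g (a r.1) (b r.1)) : ℝ) :=
    (hc.comp measurable_fst).inner hN
  have hmem := (hG.memLp_noise hg ha hb hX hζ hlaw hind).1
  have hintΩ : Integrable (fun ω => (inner ℝ (c (X ω))
        (G (a (X ω)) (b (X ω)) (ζ ω) - g (a (X ω)) (b (X ω))) : ℝ)) P := by
    refine (hcX.integrable_norm_pow two_ne_zero |>.add
      (hmem.integrable_norm_pow two_ne_zero)).mono' (hF.comp hpair).aestronglyMeasurable
      (.of_forall fun ω => ?_)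
    refine (norm_inner_le_norm _ _).trans ?_
    simp only [Pi.add_apply]
    nlinarith [sq_nonneg (‖c (X ω)‖ - ‖G (a (X ω)) (b (X ω)) (ζ ω) - g (a (X ω)) (b (X ω))‖),
      sq_nonneg ‖c (X ω)‖, sq_nonneg ‖G (a (X ω)) (b (X ω)) (ζ ω) - g (a (X ω)) (b (X ω))‖]
  refine ⟨hintΩ, ?_⟩
  have h1 := integral_map (μ := P) hpair.aemeasurable hF.aestronglyMeasurable
  have hint := (integrable_map_measure hF.aestronglyMeasurable hpair.aemeasurable).2 hintΩ
  rw [hmap] at hint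
  rw [← h1, hmap, integral_prod _ hint]
  refine integral_eq_zero_of_ae (.of_forall fun s => ?_)
  change ∫ e, inner ℝ (c s) (G (a s) (b s) e - g (a s) (b s)) ∂D = 0
  have h2 : Integrable (fun e => G (a s) (b s) e - g (a s) (b s)) D :=
    (hG.integrable _ _).sub (integrable_const _)
  rw [integral_inner h2, integral_sub (hG.integrable _ _) (integrable_const _), hG.unbiased]
  simp

end Noise

/-! ### The information available before a sample is drawn -/

/-- The σ-algebra generated by the samples `ξ 0, …, ξ (n - 1)`. -/
@[reducible]
def samplesBefore [MeasurableSpace Ξ] (ξ : ℕ → Ω → Ξ) (n : ℕ) : MeasurableSpace Ω :=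
  ⨆ i ∈ Set.Iio n, MeasurableSpace.comap (ξ i) inferInstance

section Samples

variable [MeasurableSpace Ξ] {ξ : ℕ → Ω → Ξ}

lemma samplesBefore_mono {m n : ℕ} (h : m ≤ n) : samplesBefore ξ m ≤ samplesBefore ξ n :=
  biSup_mono fun _ hi => lt_of_lt_of_le hi h

lemma samplesBefore_le [MeasurableSpace Ω] (hξ : ∀ i, Measurable (ξ i)) (n : ℕ) :
    samplesBefore ξ n ≤ (inferInstance : MeasurableSpace Ω) :=
  iSup₂_le fun i _ => (hξ i).comap_le

lemma measurable_sample {i n : ℕ} (h : i < n) : Measurable[samplesBefore ξ n] (ξ i) :=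
  Measurable.mono (comap_measurable (ξ i))
    (le_iSup₂_of_le (f := fun i _ => MeasurableSpace.comap (ξ i) inferInstance) i h le_rfl) le_rfl

lemma IIDSamples.indepFun [MeasurableSpace Ω] [MeasurableSpace S] {P : Measure Ω}
    {D : Measure Ξ} (hξ : IIDSamples P D ξ) {n : ℕ} {X : Ω → S}
    (hX : Measurable[samplesBefore ξ n] X) : IndepFun X (ξ n) P := by
  have h := indep_iSup_of_disjoint (fun i => (hξ.measurable i).comap_le) hξ.indep
    (S := Set.Iio n) (T := {n}) (by simp)
  rw [IndepFun_iff_Indep]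
  refine indep_of_indep_of_le_left (indep_of_indep_of_le_right h ?_) hX.comap_le
  simp

end Samples

/-! ### The iterates as a stochastic process -/

/-- The sequences `x`, `y`, `z` of random iterates of Stochastic Smoothed-AGDA with samples `ξ`:
iteration `t` uses the samples `ξ (2 * t)` and `ξ (2 * t + 1)`. -/
structure IsIterates (Gx : Vec d₁ → Vec d₂ → Ξ → Vec d₁) (Gy : Vec d₁ → Vec d₂ → Ξ → Vec d₂)
    (τ₁ τ₂ p β : ℝ) (x₀ : Vec d₁) (y₀ : Vec d₂) (z₀ : Vec d₁) (ξ : ℕ → Ω → Ξ)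
    (x : ℕ → Ω → Vec d₁) (y : ℕ → Ω → Vec d₂) (z : ℕ → Ω → Vec d₁) : Prop where
  x_zero : ∀ ω, x 0 ω = x₀
  y_zero : ∀ ω, y 0 ω = y₀
  z_zero : ∀ ω, z 0 ω = z₀
  x_succ : ∀ t ω, x (t + 1) ω =
    x t ω - τ₁ • (Gx (x t ω) (y t ω) (ξ (2 * t) ω) + p • (x t ω - z t ω))
  y_succ : ∀ t ω, y (t + 1) ω = y t ω + τ₂ • Gy (x (t + 1) ω) (y t ω) (ξ (2 * t + 1) ω)
  z_succ : ∀ t ω, z (t + 1) ω = z t ω + β • (x (t + 1) ω - z t ω)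

lemma run_drawn (Gx : Vec d₁ → Vec d₂ → Ξ → Vec d₁) (Gy : Vec d₁ → Vec d₂ → Ξ → Vec d₂)
    (τ₁ τ₂ p β : ℝ) (x₀ : Vec d₁) (y₀ : Vec d₂) (z₀ : Vec d₁) (s : ℕ → Ξ) (t : ℕ) :
    (run Gx Gy τ₁ τ₂ p β x₀ y₀ z₀ s t).drawn = 2 * t := by
  induction t with
  | zero => rfl
  | succ t ih => simp only [run, step, ih]; ring

lemma isIterates_run (Gx : Vec d₁ → Vec d₂ → Ξ → Vec d₁) (Gy : Vec d₁ → Vec d₂ → Ξ → Vec d₂)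
    (τ₁ τ₂ p β : ℝ) (x₀ : Vec d₁) (y₀ : Vec d₂) (z₀ : Vec d₁) (ξ : ℕ → Ω → Ξ) :
    IsIterates Gx Gy τ₁ τ₂ p β x₀ y₀ z₀ ξ
      (fun t ω => (run Gx Gy τ₁ τ₂ p β x₀ y₀ z₀ (fun i => ξ i ω) t).x)
      (fun t ω => (run Gx Gy τ₁ τ₂ p β x₀ y₀ z₀ (fun i => ξ i ω) t).y)
      (fun t ω => (run Gx Gy τ₁ τ₂ p β x₀ y₀ z₀ (fun i => ξ i ω) t).z) where
  x_zero _ := rfl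
  y_zero _ := rfl
  z_zero _ := rfl
  x_succ t ω := by simp only [run, step, run_drawn]
  y_succ t ω := by simp only [run, step, run_drawn]
  z_succ t ω := by simp only [run, step]

section Measurability

variable [MeasurableSpace Ξ] {D : Measure Ξ} {G : Vec d₁ → Vec d₂ → Ξ → Vec d}
  {g : Vec d₁ → Vec d₂ → Vec d} {σ : ℝ}

lemma StochasticGradient.measurable_comp {α : Type*} {m : MeasurableSpace α}
    (hG : StochasticGradient D G g σ) {x : α → Vec d₁} {y : α → Vec d₂} {ζ : α → Ξ}
    (hx : Measurable[m] x) (hy : Measurable[m] y) (hζ : Measurable[m] ζ) :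
    Measurable[m] fun a => G (x a) (y a) (ζ a) :=
  hG.measurable.comp (hx.prodMk (hy.prodMk hζ))

end Measurability

section Iterates

variable [MeasurableSpace Ξ] {D : Measure Ξ} {Gx : Vec d₁ → Vec d₂ → Ξ → Vec d₁}
  {Gy : Vec d₁ → Vec d₂ → Ξ → Vec d₂} {gx : Vec d₁ → Vec d₂ → Vec d₁}
  {gy : Vec d₁ → Vec d₂ → Vec d₂}
  {σ τ₁ τ₂ p β : ℝ} {x₀ : Vec d₁} {y₀ : Vec d₂} {z₀ : Vec d₁} {ξ : ℕ → Ω → Ξ}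
  {x : ℕ → Ω → Vec d₁} {y : ℕ → Ω → Vec d₂} {z : ℕ → Ω → Vec d₁}

lemma IsIterates.measurable_x_succ_of (hit : IsIterates Gx Gy τ₁ τ₂ p β x₀ y₀ z₀ ξ x y z)
    (hGx : StochasticGradient D Gx gx σ) {t : ℕ} (hx : Measurable[samplesBefore ξ (2 * t)] (x t))
    (hy : Measurable[samplesBefore ξ (2 * t)] (y t))
    (hz : Measurable[samplesBefore ξ (2 * t)] (z t)) :
    Measurable[samplesBefore ξ (2 * t + 1)] (x (t + 1)) := by
  have hm := samplesBefore_mono (ξ := ξ) (Nat.le_succ (2 * t))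
  have hx' := hx.mono hm le_rfl
  have h := hx'.sub (((hGx.measurable_comp hx' (hy.mono hm le_rfl)
    (measurable_sample (Nat.lt_succ_self (2 * t)))).add
    ((hx'.sub (hz.mono hm le_rfl)).const_smul p)).const_smul τ₁)
  exact (funext (hit.x_succ t) : x (t + 1) = _) ▸ h

/-- The iterates at time `t` are functions of the first `2 * t` samples. -/
lemma IsIterates.measurable (hit : IsIterates Gx Gy τ₁ τ₂ p β x₀ y₀ z₀ ξ x y z)
    (hGx : StochasticGradient D Gx gx σ) (hGy : StochasticGradient D Gy gy σ) (t : ℕ) :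
    Measurable[samplesBefore ξ (2 * t)] (x t) ∧ Measurable[samplesBefore ξ (2 * t)] (y t) ∧
      Measurable[samplesBefore ξ (2 * t)] (z t) := by
  induction t with
  | zero =>
    rw [funext hit.x_zero, funext hit.y_zero, funext hit.z_zero]
    exact ⟨measurable_const, measurable_const, measurable_const⟩
  | succ t ih =>
    obtain ⟨hx, hy, hz⟩ := ih
    have hm1 := samplesBefore_mono (ξ := ξ) (show 2 * t + 1 ≤ 2 * (t + 1) by lia)
    have hm := samplesBefore_mono (ξ := ξ) (show 2 * t ≤ 2 * (t + 1) by lia)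
    have hx' := (hit.measurable_x_succ_of hGx hx hy hz).mono hm1 le_rfl
    have hy' := hy.mono hm le_rfl
    have hz' := hz.mono hm le_rfl
    refine ⟨hx', ?_, ?_⟩
    · have h := hy'.add ((hGy.measurable_comp hx' hy'
        (measurable_sample (show 2 * t + 1 < 2 * (t + 1) by lia))).const_smul τ₂)
      exact (funext (hit.y_succ t) : y (t + 1) = _) ▸ h
    · have h := hz'.add ((hx'.sub hz').const_smul β)
      exact (funext (hit.z_succ t) : z (t + 1) = _) ▸ h

lemma IsIterates.measurable_x_succ (hit : IsIterates Gx Gy τ₁ τ₂ p β x₀ y₀ z₀ ξ x y z)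
    (hGx : StochasticGradient D Gx gx σ) (hGy : StochasticGradient D Gy gy σ) (t : ℕ) :
    Measurable[samplesBefore ξ (2 * t + 1)] (x (t + 1)) :=
  have h := hit.measurable hGx hGy t
  hit.measurable_x_succ_of hGx h.1 h.2.1 h.2.2

end Iterates

end SmoothedAGDA

namespace SmoothedAGDA

/-! ### Square integrability of the iterates -/

variable {d₁ d₂ d : ℕ} {f : Vec d₁ → Vec d₂ → ℝ} {l μ : ℝ}

lemma continuous_of_norm_sub_le {E F H : Type*} [NormedAddCommGroup E] [NormedAddCommGroup F]
    [NormedAddCommGroup H] {φ : E → F → H} {C : ℝ} (hC : 0 ≤ C)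
    (h : ∀ a a' b b', ‖φ a b - φ a' b'‖ ≤ C * (‖a - a'‖ + ‖b - b'‖)) :
    Continuous fun q : E × F => φ q.1 q.2 := by
  refine (LipschitzWith.of_dist_le' (K := 2 * C) fun q q' => ?_).continuous
  rw [dist_eq_norm, dist_eq_norm]
  have h1 := norm_fst_le (q - q')
  have h2 := norm_snd_le (q - q')
  calc _ ≤ C * (‖q.1 - q'.1‖ + ‖q.2 - q'.2‖) := h _ _ _ _
    _ ≤ C * (‖q - q'‖ + ‖q - q'‖) := by gcongr <;> assumption
    _ = _ := by ring

lemma memLp_two_of_norm_sub_le {E F H Ω : Type*} [NormedAddCommGroup E] [NormedAddCommGroup F]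
    [NormedAddCommGroup H] [MeasurableSpace Ω] {P : Measure Ω} [IsProbabilityMeasure P]
    {φ : E → F → H} {C : ℝ} (hC : 0 ≤ C)
    (h : ∀ a a' b b', ‖φ a b - φ a' b'‖ ≤ C * (‖a - a'‖ + ‖b - b'‖)) {X : Ω → E} {Y : Ω → F}
    (hX : MemLp X 2 P) (hY : MemLp Y 2 P) : MemLp (fun ω => φ (X ω) (Y ω)) 2 P := by
  have hb : MemLp (fun ω => ‖φ 0 0‖ + C * (‖X ω‖ + ‖Y ω‖)) 2 P :=
    (memLp_const ‖φ 0 0‖).add ((hX.norm.add hY.norm).const_mul C)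
  refine hb.of_le ?_ (.of_forall fun ω => ?_)
  · exact (continuous_of_norm_sub_le hC h).comp_aestronglyMeasurable
      (hX.aestronglyMeasurable.prodMk hY.aestronglyMeasurable)
  · have h1 := h (X ω) 0 (Y ω) 0
    rw [sub_zero, sub_zero] at h1
    have h2 := norm_le_norm_add_norm_sub' (φ (X ω) (Y ω)) (φ 0 0)
    exact (h2.trans (add_le_add_right h1 _)).trans (le_abs_self _)

lemma LipschitzSmooth.continuous_gradX (hf : LipschitzSmooth f l) (hl : 0 < l) :
    Continuous fun q : Vec d₁ × Vec d₂ => gradX f q.1 q.2 :=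
  continuous_of_norm_sub_le hl.le hf.lipschitz_x

lemma LipschitzSmooth.continuous_gradY (hf : LipschitzSmooth f l) (hl : 0 < l) :
    Continuous fun q : Vec d₁ × Vec d₂ => gradY f q.1 q.2 :=
  continuous_of_norm_sub_le hl.le hf.lipschitz_y

lemma norm_proxArg_sub_le' (hf : LipschitzSmooth f l) (hl : 0 < l) (y y' : Vec d₂)
    (z z' : Vec d₁) :
    ‖proxArg f l y z - proxArg f l y' z'‖ ≤ 2 * (‖y - y'‖ + ‖z - z'‖) := by
  linarith [norm_proxArg_sub_le hf hl y y' z z', norm_nonneg (y - y')]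

section Iterates

variable {Ω Ξ : Type*} [MeasurableSpace Ω] [MeasurableSpace Ξ] {P : Measure Ω} {D : Measure Ξ}
  {Gx : Vec d₁ → Vec d₂ → Ξ → Vec d₁} {Gy : Vec d₁ → Vec d₂ → Ξ → Vec d₂}
  {σ τ₁ τ₂ p β : ℝ} {x₀ : Vec d₁} {y₀ : Vec d₂} {z₀ : Vec d₁} {ξ : ℕ → Ω → Ξ}
  {x : ℕ → Ω → Vec d₁} {y : ℕ → Ω → Vec d₂} {z : ℕ → Ω → Vec d₁}

/-- The noise in the stochastic gradient used in the `x`-step of iteration `t`. -/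
def noiseX (f : Vec d₁ → Vec d₂ → ℝ) (Gx : Vec d₁ → Vec d₂ → Ξ → Vec d₁) (ξ : ℕ → Ω → Ξ)
    (x : ℕ → Ω → Vec d₁) (y : ℕ → Ω → Vec d₂) (t : ℕ) (ω : Ω) : Vec d₁ :=
  Gx (x t ω) (y t ω) (ξ (2 * t) ω) - gradX f (x t ω) (y t ω)

/-- The noise in the stochastic gradient used in the `y`-step of iteration `t`. -/
def noiseY (f : Vec d₁ → Vec d₂ → ℝ) (Gy : Vec d₁ → Vec d₂ → Ξ → Vec d₂) (ξ : ℕ → Ω → Ξ)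
    (x : ℕ → Ω → Vec d₁) (y : ℕ → Ω → Vec d₂) (t : ℕ) (ω : Ω) : Vec d₂ :=
  Gy (x (t + 1) ω) (y t ω) (ξ (2 * t + 1) ω) - gradY f (x (t + 1) ω) (y t ω)

/-- The difference `∇_y f(x_{t+1}, y_t) - 2 ∇_y Ψ(y_t; z_t)`, which multiplies the noise of the
`y`-step in the change of the potential. -/
def driftY (f : Vec d₁ → Vec d₂ → ℝ) (l : ℝ) (q : Vec d₁ × Vec d₂ × Vec d₁) : Vec d₂ :=
  gradY f q.1 q.2.1 - (2 : ℝ) • gradY f (proxArg f l q.2.1 q.2.2) q.2.1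

variable [IsProbabilityMeasure P] [IsProbabilityMeasure D]

lemma IsIterates.noiseX_sq (hit : IsIterates Gx Gy τ₁ τ₂ p β x₀ y₀ z₀ ξ x y z)
    (hf : LipschitzSmooth f l) (hl : 0 < l) (hGx : StochasticGradient D Gx (gradX f) σ)
    (hGy : StochasticGradient D Gy (gradY f) σ) (hξ : IIDSamples P D ξ) (t : ℕ) :
    MemLp (noiseX f Gx ξ x y t) 2 P ∧ ∫ ω, ‖noiseX f Gx ξ x y t ω‖ ^ 2 ∂P ≤ σ ^ 2 := by
  obtain ⟨hx, hy, hz⟩ := hit.measurable hGx hGy t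
  have hX := hx.prodMk hy
  exact hGx.memLp_noise (X := fun ω => (x t ω, y t ω)) (hf.continuous_gradX hl).measurable measurable_fst measurable_snd
    (hX.mono (samplesBefore_le hξ.measurable _) le_rfl) (hξ.measurable _) (hξ.law _)
    (hξ.indepFun hX)

lemma IsIterates.noiseY_sq (hit : IsIterates Gx Gy τ₁ τ₂ p β x₀ y₀ z₀ ξ x y z)
    (hf : LipschitzSmooth f l) (hl : 0 < l) (hGx : StochasticGradient D Gx (gradX f) σ)
    (hGy : StochasticGradient D Gy (gradY f) σ) (hξ : IIDSamples P D ξ) (t : ℕ) :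
    MemLp (noiseY f Gy ξ x y t) 2 P ∧ ∫ ω, ‖noiseY f Gy ξ x y t ω‖ ^ 2 ∂P ≤ σ ^ 2 := by
  have hX := (hit.measurable_x_succ hGx hGy t).prodMk
    ((hit.measurable hGx hGy t).2.1.mono (samplesBefore_mono (Nat.le_succ _)) le_rfl)
  exact hGy.memLp_noise (X := fun ω => (x (t + 1) ω, y t ω)) (hf.continuous_gradY hl).measurable measurable_fst measurable_snd
    (hX.mono (samplesBefore_le hξ.measurable _) le_rfl) (hξ.measurable _) (hξ.law _)
    (hξ.indepFun hX)

lemma memLp_gradX (hf : LipschitzSmooth f l) (hl : 0 < l) {X : Ω → Vec d₁} {Y : Ω → Vec d₂}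
    (hX : MemLp X 2 P) (hY : MemLp Y 2 P) : MemLp (fun ω => gradX f (X ω) (Y ω)) 2 P :=
  memLp_two_of_norm_sub_le hl.le hf.lipschitz_x hX hY

lemma memLp_gradY (hf : LipschitzSmooth f l) (hl : 0 < l) {X : Ω → Vec d₁} {Y : Ω → Vec d₂}
    (hX : MemLp X 2 P) (hY : MemLp Y 2 P) : MemLp (fun ω => gradY f (X ω) (Y ω)) 2 P :=
  memLp_two_of_norm_sub_le hl.le hf.lipschitz_y hX hY

/-- All iterates are square integrable. -/
lemma IsIterates.memLp (hit : IsIterates Gx Gy τ₁ τ₂ p β x₀ y₀ z₀ ξ x y z)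
    (hf : LipschitzSmooth f l) (hl : 0 < l) (hGx : StochasticGradient D Gx (gradX f) σ)
    (hGy : StochasticGradient D Gy (gradY f) σ) (hξ : IIDSamples P D ξ) (t : ℕ) :
    MemLp (x t) 2 P ∧ MemLp (y t) 2 P ∧ MemLp (z t) 2 P := by
  induction t with
  | zero =>
    rw [funext hit.x_zero, funext hit.y_zero, funext hit.z_zero]
    exact ⟨memLp_const _, memLp_const _, memLp_const _⟩
  | succ t ih =>
    obtain ⟨hx, hy, hz⟩ := ih
    have hx' : MemLp (x (t + 1)) 2 P := by
      have h := hx.sub ((((hit.noiseX_sq hf hl hGx hGy hξ t).1.add (memLp_gradX hf hl hx hy)).add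
        ((hx.sub hz).const_smul p)).const_smul τ₁)
      have e : x (t + 1) = _ := funext fun ω => (hit.x_succ t ω).trans
        (show _ = x t ω - τ₁ • (noiseX f Gx ξ x y t ω + gradX f (x t ω) (y t ω)
          + p • (x t ω - z t ω)) by rw [noiseX, sub_add_cancel])
      exact e ▸ h
    refine ⟨hx', ?_, ?_⟩
    · have h := hy.add (((hit.noiseY_sq hf hl hGx hGy hξ t).1.add
        (memLp_gradY hf hl hx' hy)).const_smul τ₂)
      have e : y (t + 1) = _ := funext fun ω => (hit.y_succ t ω).trans
        (show _ = y t ω + τ₂ • (noiseY f Gy ξ x y t ω + gradY f (x (t + 1) ω) (y t ω)) by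
          rw [noiseY, sub_add_cancel])
      exact e ▸ h
    · have h := hz.add ((hx'.sub hz).const_smul β)
      exact (funext (hit.z_succ t) : z (t + 1) = _) ▸ h

lemma IsIterates.integral_inner_noiseX (hit : IsIterates Gx Gy τ₁ τ₂ p β x₀ y₀ z₀ ξ x y z)
    (hf : LipschitzSmooth f l) (hl : 0 < l) (hGx : StochasticGradient D Gx (gradX f) σ)
    (hGy : StochasticGradient D Gy (gradY f) σ) (hξ : IIDSamples P D ξ) (t : ℕ) :
    Integrable (fun ω => inner ℝ (proxGrad f l (x t ω) (y t ω) (z t ω))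
        (noiseX f Gx ξ x y t ω)) P ∧
      ∫ ω, inner ℝ (proxGrad f l (x t ω) (y t ω) (z t ω)) (noiseX f Gx ξ x y t ω) ∂P = 0 := by
  obtain ⟨hx, hy, hz⟩ := hit.measurable hGx hGy t
  obtain ⟨hx2, hy2, hz2⟩ := hit.memLp hf hl hGx hGy hξ t
  have hX := hx.prodMk (hy.prodMk hz)
  have hc : Continuous fun q : Vec d₁ × Vec d₂ × Vec d₁ => proxGrad f l q.1 q.2.1 q.2.2 := by
    have h := (hf.continuous_gradX hl).comp
      (continuous_fst.prodMk (continuous_fst.comp continuous_snd) :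
        Continuous fun q : Vec d₁ × Vec d₂ × Vec d₁ => (q.1, q.2.1))
    exact h.add ((continuous_fst.sub (continuous_snd.comp continuous_snd)).const_smul (2 * l))
  exact hGx.integral_inner_noise (X := fun ω => (x t ω, y t ω, z t ω))
    (c := fun q => proxGrad f l q.1 q.2.1 q.2.2) (b := fun q => q.2.1)
    (hf.continuous_gradX hl).measurable measurable_fst (measurable_fst.comp measurable_snd)
    (hX.mono (samplesBefore_le hξ.measurable _) le_rfl) (hξ.measurable _) (hξ.law _)
    (hξ.indepFun hX) hc.measurable
    ((memLp_gradX hf hl hx2 hy2).add ((hx2.sub hz2).const_smul (2 * l)))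

lemma IsIterates.integral_inner_noiseY (hit : IsIterates Gx Gy τ₁ τ₂ p β x₀ y₀ z₀ ξ x y z)
    (hf : LipschitzSmooth f l) (hl : 0 < l) (hGx : StochasticGradient D Gx (gradX f) σ)
    (hGy : StochasticGradient D Gy (gradY f) σ) (hξ : IIDSamples P D ξ) (t : ℕ) :
    Integrable (fun ω => inner ℝ (driftY f l (x (t + 1) ω, y t ω, z t ω))
        (noiseY f Gy ξ x y t ω)) P ∧
      ∫ ω, inner ℝ (driftY f l (x (t + 1) ω, y t ω, z t ω)) (noiseY f Gy ξ x y t ω) ∂P = 0 := by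
  obtain ⟨-, hy, hz⟩ := hit.measurable hGx hGy t
  obtain ⟨-, hy2, hz2⟩ := hit.memLp hf hl hGx hGy hξ t
  obtain ⟨hx2, -, -⟩ := hit.memLp hf hl hGx hGy hξ (t + 1)
  have hm := samplesBefore_mono (ξ := ξ) (Nat.le_succ (2 * t))
  have hX := (hit.measurable_x_succ hGx hGy t).prodMk
    ((hy.mono hm le_rfl).prodMk (hz.mono hm le_rfl))
  have hprox := continuous_of_norm_sub_le zero_le_two (norm_proxArg_sub_le' hf hl)
  have hc : Continuous (driftY f l) := by
    have hy' : Continuous fun q : Vec d₁ × Vec d₂ × Vec d₁ => q.2.1 :=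
      continuous_fst.comp continuous_snd
    have h := (hf.continuous_gradY hl).comp (continuous_fst.prodMk hy')
    have h' := (hf.continuous_gradY hl).comp ((hprox.comp continuous_snd).prodMk hy')
    exact h.sub (h'.const_smul (2 : ℝ))
  exact hGy.integral_inner_noise (X := fun ω => (x (t + 1) ω, y t ω, z t ω)) (c := driftY f l)
    (b := fun q => q.2.1)
    (hf.continuous_gradY hl).measurable measurable_fst (measurable_fst.comp measurable_snd)
    (hX.mono (samplesBefore_le hξ.measurable _) le_rfl) (hξ.measurable _) (hξ.law _)
    (hξ.indepFun hX) hc.measurable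
    ((memLp_gradY hf hl hx2 hy2).sub ((memLp_gradY hf hl
      (memLp_two_of_norm_sub_le zero_le_two (norm_proxArg_sub_le' hf hl) hy2 hz2)
      hy2).const_smul (2 : ℝ)))

end Iterates

/-! ### Summing the potential decrease -/

/-- A pathwise potential argument in expectation; the potential `V` itself need not be
measurable. -/
lemma sum_integral_le_of_potential {Ω : Type*} [MeasurableSpace Ω] {P : Measure Ω}
    [IsProbabilityMeasure P] {A B V : ℕ → Ω → ℝ} {K v c b : ℝ} (hK : 0 ≤ K)
    (hA : ∀ t, Integrable (A t) P) (hB : ∀ t, Integrable (B t) P)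
    (hstep : ∀ t ω, A t ω ≤ K * (V t ω - V (t + 1) ω + B t ω)) (hv : ∀ ω, V 0 ω ≤ v)
    (hc : ∀ t ω, c ≤ V t ω) (hb : ∀ t, ∫ ω, B t ω ∂P ≤ b) (T : ℕ) :
    ∑ t ∈ Finset.range T, ∫ ω, A t ω ∂P ≤ K * (v - c + T * b) := by
  rw [← integral_finsetSum _ fun t _ => hA t]
  have hpath : ∀ ω, ∑ t ∈ Finset.range T, A t ω
      ≤ K * (v - c + ∑ t ∈ Finset.range T, B t ω) := fun ω => by
    calc ∑ t ∈ Finset.range T, A t ω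
        ≤ ∑ t ∈ Finset.range T, K * (V t ω - V (t + 1) ω + B t ω) :=
          Finset.sum_le_sum fun t _ => hstep t ω
      _ = K * (V 0 ω - V T ω + ∑ t ∈ Finset.range T, B t ω) := by
          rw [← Finset.mul_sum, Finset.sum_add_distrib, Finset.sum_range_sub']
      _ ≤ _ := by gcongr <;> [exact hv ω; exact hc T ω]
  have hBs : Integrable (fun ω => ∑ t ∈ Finset.range T, B t ω) P :=
    integrable_finsetSum _ fun t _ => hB t
  calc ∫ ω, ∑ t ∈ Finset.range T, A t ω ∂P
      ≤ ∫ ω, K * (v - c + ∑ t ∈ Finset.range T, B t ω) ∂P :=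
        integral_mono (integrable_finsetSum _ fun t _ => hA t)
          (((integrable_const _).add hBs).const_mul K) hpath
    _ = K * (v - c + ∑ t ∈ Finset.range T, ∫ ω, B t ω ∂P) := by
        rw [integral_const_mul, integral_add (integrable_const _) hBs,
          integral_finsetSum _ fun t _ => hB t]
        simp
    _ ≤ _ := by
        gcongr
        calc _ ≤ ∑ _t ∈ Finset.range T, b := Finset.sum_le_sum fun t _ => hb t
          _ = T * b := by simp

section Rate

variable {Ω Ξ : Type*} [MeasurableSpace Ω] [MeasurableSpace Ξ] {P : Measure Ω} {D : Measure Ξ}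
  {Gx : Vec d₁ → Vec d₂ → Ξ → Vec d₁} {Gy : Vec d₁ → Vec d₂ → Ξ → Vec d₂}
  {σ τ₁ τ₂ β : ℝ} {x₀ : Vec d₁} {y₀ : Vec d₂} {z₀ : Vec d₁} {ξ : ℕ → Ω → Ξ}
  {x : ℕ → Ω → Vec d₁} {y : ℕ → Ω → Vec d₂} {z : ℕ → Ω → Vec d₁}
  [IsProbabilityMeasure P] [IsProbabilityMeasure D]

/-- The convergence rate for any step sizes with `τ₁ = 48 τ₂ ≤ 1 / (3 l)`. -/
theorem IsIterates.sum_integral_le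
    (hit : IsIterates Gx Gy τ₁ τ₂ (2 * l) β x₀ y₀ z₀ ξ x y z)
    (hf : LipschitzSmooth f l) (hpl : PLInY f μ) (hμ : 0 < μ) (hμl : μ ≤ l)
    (hGx : StochasticGradient D Gx (gradX f) σ)
    (hGy : StochasticGradient D Gy (gradY f) σ) (hξ : IIDSamples P D ξ) {Φstar : ℝ}
    (hΦ : ∀ x, Φstar ≤ primal f x) (hτ₂ : 0 < τ₂) (hτ : τ₁ = 48 * τ₂)
    (hτl : 144 * l * τ₂ ≤ 1) (hβ : β = τ₂ * μ / 1600) (T : ℕ) :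
    ∑ t ∈ Finset.range T, ∫ ω, τ₂ * (μ * ‖gradX f (x t ω) (y t ω)‖ ^ 2
        + l * ‖gradY f (x t ω) (y t ω)‖ ^ 2) ∂P
      ≤ 160000 * l * (primal f z₀ + 2 * gap (aux f (2 * l) z₀) x₀ y₀ - Φstar
        + T * (4 * l * τ₁ ^ 2 * σ ^ 2)) := by
  have hl : 0 < l := hμ.trans_le hμl
  have hu := hit.noiseX_sq hf hl hGx hGy hξ
  have hv := hit.noiseY_sq hf hl hGx hGy hξ
  have hgu := hit.integral_inner_noiseX hf hl hGx hGy hξ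
  have hdv := hit.integral_inner_noiseY hf hl hGx hGy hξ
  have hmem := hit.memLp hf hl hGx hGy hξ
  have huI := fun t => (hu t).1.integrable_norm_pow two_ne_zero
  have hvI := fun t => (hv t).1.integrable_norm_pow two_ne_zero
  have hI1 := fun t => (hgu t).1.const_mul (-(τ₁ * (1 - 3 * l * τ₁)))
  have hI2 := fun t => (hdv t).1.const_mul τ₂
  have hI12 : ∀ t, Integrable (fun ω =>
      -(τ₁ * (1 - 3 * l * τ₁)) * inner ℝ (proxGrad f l (x t ω) (y t ω) (z t ω))
          (noiseX f Gx ξ x y t ω)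
        + τ₂ * inner ℝ (driftY f l (x (t + 1) ω, y t ω, z t ω)) (noiseY f Gy ξ x y t ω)) P :=
    fun t => (hI1 t).add (hI2 t)
  have hI3 : ∀ t, Integrable (fun ω =>
      2 * l * τ₁ ^ 2 * (‖noiseX f Gx ξ x y t ω‖ ^ 2 + ‖noiseY f Gy ξ x y t ω‖ ^ 2)) P :=
    fun t => ((huI t).add (hvI t)).const_mul (2 * l * τ₁ ^ 2)
  refine sum_integral_le_of_potential
    (V := fun t ω => potential f l (x t ω) (y t ω) (z t ω))
    (B := fun t ω =>
      -(τ₁ * (1 - 3 * l * τ₁)) * inner ℝ (proxGrad f l (x t ω) (y t ω) (z t ω))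
          (noiseX f Gx ξ x y t ω)
        + τ₂ * inner ℝ (driftY f l (x (t + 1) ω, y t ω, z t ω)) (noiseY f Gy ξ x y t ω)
        + 2 * l * τ₁ ^ 2 * (‖noiseX f Gx ξ x y t ω‖ ^ 2 + ‖noiseY f Gy ξ x y t ω‖ ^ 2))
    (by positivity) (fun t => ?_) (fun t => ?_) (fun t ω => ?_) (fun ω => ?_)
    (fun t ω => le_potential hf hpl hl hΦ _ _ _) (fun t => ?_) T
  · have h1 := (memLp_gradX hf hl (hmem t).1 (hmem t).2.1).integrable_norm_pow two_ne_zero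
    have h2 := (memLp_gradY hf hl (hmem t).1 (hmem t).2.1).integrable_norm_pow two_ne_zero
    exact ((h1.const_mul μ).add (h2.const_mul l)).const_mul τ₂
  · exact (hI12 t).add (hI3 t)
  · have h := stationarity_le_potential_decrease hf hpl hμ hμl hτ₂ hτ hτl hβ
      (x t ω) (z t ω) (noiseX f Gx ξ x y t ω) (y t ω) (noiseY f Gy ξ x y t ω)
      (x' := x (t + 1) ω) (y' := y (t + 1) ω) (z' := z (t + 1) ω)
      (by rw [hit.x_succ, noiseX, proxGrad]; congr 2; abel)
      (by rw [hit.y_succ, noiseY, add_sub_cancel]) (hit.z_succ t ω)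
    refine h.trans (le_of_eq ?_)
    simp only [driftY]
    ring
  · rw [hit.x_zero, hit.y_zero, hit.z_zero]
    exact potential_le hf hpl hl x₀ y₀ z₀
  · have e1 : ∫ ω, (‖noiseX f Gx ξ x y t ω‖ ^ 2 + ‖noiseY f Gy ξ x y t ω‖ ^ 2) ∂P
        ≤ 2 * σ ^ 2 := by
      rw [integral_add (huI t) (hvI t)]
      linarith [(hu t).2, (hv t).2]
    rw [integral_add (hI12 t) (hI3 t), integral_add (hI1 t) (hI2 t),
      integral_const_mul, integral_const_mul, integral_const_mul, (hgu t).2, (hdv t).2]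
    have := mul_le_mul_of_nonneg_left e1 (show 0 ≤ 2 * l * τ₁ ^ 2 by positivity)
    linarith

end Rate

end SmoothedAGDA

namespace SmoothedAGDA

/-! ### From the potential bound to the convergence rate -/

lemma inv_min_le_add {a b : ℝ} (ha : 0 < a) (hb : 0 < b) : (min a b)⁻¹ ≤ a⁻¹ + b⁻¹ := by
  rcases le_total a b with h | h
  · rw [min_eq_left h]; linarith [inv_pos.2 hb]
  · rw [min_eq_right h]; linarith [inv_pos.2 ha]

/-- The step sizes `τ₁` and `τ₂` have the fixed ratio `48`. -/
lemma step_size_ratio (Δ σ l T : ℝ) :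
    min (√Δ / (2 * σ * √(T * l))) (1 / (3 * l))
      = 48 * min (√Δ / (96 * σ * √(T * l))) (1 / (144 * l)) := by
  rw [mul_min_of_nonneg _ _ (by norm_num)]
  congr 1
  · rw [show 96 * σ * √(T * l) = 48 * (2 * σ * √(T * l)) by ring, ← mul_div_assoc,
      mul_div_mul_left _ _ (by norm_num)]
  · rw [show 144 * l = 48 * (3 * l) by ring, ← mul_div_assoc,
      mul_div_mul_left _ _ (by norm_num)]

/-- The bound of the potential argument, divided by `T τ₂ μ`, has the form of the convergence
rate. -/
lemma rate_of_potential_bound {Δ σ l μ κ b₀ τ₁ τ₂ S : ℝ} {T : ℕ} (hl : 0 < l) (hμ : 0 < μ)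
    (hκ : κ = l / μ) (hσ : 0 < σ) (hT : 1 ≤ T) (hΔ : 0 < Δ) (hb₀ : 0 ≤ b₀)
    (hτ₁ : τ₁ = min (√Δ / (2 * σ * √(T * l))) (1 / (3 * l)))
    (hτ₂ : τ₂ = min (√Δ / (96 * σ * √(T * l))) (1 / (144 * l)))
    (hS : τ₂ * μ * S ≤ 160000 * l * (Δ + b₀ + T * (4 * l * τ₁ ^ 2 * σ ^ 2))) :
    1 / (T : ℝ) * S ≤ 46080000 * l * κ / T * (Δ + b₀) + 46080000 * κ * √l * b₀ / √(Δ * T) * σ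
      + 46080000 * κ * √(l * Δ) / √T * σ := by
  have hT0 : (0 : ℝ) < T := by exact_mod_cast hT
  have hsT : 0 < √(T : ℝ) := Real.sqrt_pos.2 hT0
  have hsl : 0 < √l := Real.sqrt_pos.2 hl
  have hsΔ : 0 < √Δ := Real.sqrt_pos.2 hΔ
  have eT : √(T : ℝ) ^ 2 = T := Real.sq_sqrt hT0.le
  have el : √l ^ 2 = l := Real.sq_sqrt hl.le
  have eΔ : √Δ ^ 2 = Δ := Real.sq_sqrt hΔ.le
  have hκ0 : 0 < κ := by rw [hκ]; positivity
  rw [Real.sqrt_mul hT0.le] at hτ₁ hτ₂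
  rw [Real.sqrt_mul hΔ.le, Real.sqrt_mul hl.le]
  have hτ₂0 : 0 < τ₂ := by rw [hτ₂]; positivity
  -- the noise accumulated over all iterations is at most the initial gap
  have hnoise : T * (4 * l * τ₁ ^ 2 * σ ^ 2) ≤ Δ := by
    have h1 : τ₁ ≤ √Δ / (2 * σ * (√T * √l)) := hτ₁ ▸ min_le_left _ _
    have h0 : 0 ≤ τ₁ := by rw [hτ₁]; positivity
    have h2 := pow_le_pow_left₀ h0 h1 2
    calc T * (4 * l * τ₁ ^ 2 * σ ^ 2)
        ≤ T * (4 * l * (√Δ / (2 * σ * (√T * √l))) ^ 2 * σ ^ 2) := by gcongr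
      _ = T * (4 * l * (√Δ ^ 2 / (4 * σ ^ 2 * (√T ^ 2 * √l ^ 2))) * σ ^ 2) := by ring
      _ = Δ := by rw [eT, el, eΔ]; field_simp
  have hinv : τ₂⁻¹ ≤ 96 * σ * (√T * √l) / √Δ + 144 * l := by
    have h := inv_min_le_add (a := √Δ / (96 * σ * (√T * √l))) (b := 1 / (144 * l))
      (by positivity) (by positivity)
    rwa [← hτ₂, inv_div, one_div, inv_inv] at h
  have h1 : S ≤ 160000 * κ * (2 * Δ + b₀) * τ₂⁻¹ := by
    have h2 : τ₂ * μ * S ≤ 160000 * l * (2 * Δ + b₀) :=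
      hS.trans (mul_le_mul_of_nonneg_left (by linarith) (by positivity))
    rw [hκ]
    calc S = τ₂ * μ * S / (τ₂ * μ) := by field_simp
      _ ≤ 160000 * l * (2 * Δ + b₀) / (τ₂ * μ) := by gcongr
      _ = _ := by field_simp
  have h3 : S ≤ 160000 * κ * (2 * Δ + b₀) * (96 * σ * (√T * √l) / √Δ + 144 * l) :=
    h1.trans (mul_le_mul_of_nonneg_left hinv (by positivity))
  have e1 : 1 / (T : ℝ) * (160000 * κ * (2 * Δ + b₀) * (96 * σ * (√T * √l) / √Δ + 144 * l))
      = 23040000 * l * κ / T * (2 * Δ + b₀) + 15360000 * κ * √l * b₀ / (√Δ * √T) * σ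
        + 30720000 * κ * (√l * √Δ) / √T * σ := by
    have key : ∀ s d T' Δ' : ℝ, 0 < s → 0 < d → s ^ 2 = T' → d ^ 2 = Δ' →
        1 / T' * (160000 * κ * (2 * Δ' + b₀) * (96 * σ * (s * √l) / d + 144 * l))
          = 23040000 * l * κ / T' * (2 * Δ' + b₀) + 15360000 * κ * √l * b₀ / (d * s) * σ
            + 30720000 * κ * (√l * d) / s * σ := by
      rintro s d _ _ hs hd rfl rfl
      field_simp
      ring
    exact key _ _ _ _ hsT hsΔ eT eΔ
  have h4 := mul_le_mul_of_nonneg_left h3 (show 0 ≤ 1 / (T : ℝ) by positivity)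
  have p1 : 0 ≤ l * κ / T * b₀ := by positivity
  have p2 : 0 ≤ κ * √l * b₀ / (√Δ * √T) * σ := by positivity
  have p3 : 0 ≤ κ * (√l * √Δ) / √T * σ := by positivity
  rw [e1] at h4
  refine h4.trans ?_
  have q1 : 23040000 * l * κ / T * (2 * Δ + b₀)
      = 46080000 * l * κ / T * (Δ + b₀) - 23040000 * (l * κ / T * b₀) := by ring
  have q2 : 46080000 * κ * √l * b₀ / (√Δ * √T) * σ
      = 15360000 * κ * √l * b₀ / (√Δ * √T) * σ
        + 30720000 * (κ * √l * b₀ / (√Δ * √T) * σ) := by ring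
  have q3 : 46080000 * κ * (√l * √Δ) / √T * σ = 30720000 * κ * (√l * √Δ) / √T * σ
        + 15360000 * (κ * (√l * √Δ) / √T * σ) := by ring
  linarith

/-- Inverting the convergence rate: the number of samples that makes it at most `ε ^ 2`. -/
lemma rate_le_sq {Δ σ l κ b₀ ε a : ℝ} {T : ℕ} (ha : 1 ≤ a) (hl : 0 < l) (hκ : 0 < κ)
    (hσ : 0 < σ) (hT : 1 ≤ T) (hΔ : 0 < Δ) (hb₀ : 0 ≤ b₀) (hε : 0 < ε)
    (h : 18 * a ^ 2 * (l * κ * (Δ + b₀) / ε ^ 2 + l * κ ^ 2 * (Δ + b₀ ^ 2 / Δ) * σ ^ 2 / ε ^ 4)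
      ≤ ((2 * T : ℕ) : ℝ)) :
    a * l * κ / T * (Δ + b₀) + a * κ * √l * b₀ / √(Δ * T) * σ + a * κ * √(l * Δ) / √T * σ
      ≤ ε ^ 2 := by
  have hT0 : (0 : ℝ) < T := by exact_mod_cast hT
  have eT : √(T : ℝ) ^ 2 = T := Real.sq_sqrt hT0.le
  push_cast at h
  have pA : 0 ≤ l * κ * (Δ + b₀) / ε ^ 2 := by positivity
  have pB1 : 0 ≤ l * κ ^ 2 * Δ * σ ^ 2 / ε ^ 4 := by positivity
  have pB2 : 0 ≤ l * κ ^ 2 * (b₀ ^ 2 / Δ) * σ ^ 2 / ε ^ 4 := by positivity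
  have eB : l * κ ^ 2 * (Δ + b₀ ^ 2 / Δ) * σ ^ 2 / ε ^ 4
      = l * κ ^ 2 * Δ * σ ^ 2 / ε ^ 4 + l * κ ^ 2 * (b₀ ^ 2 / Δ) * σ ^ 2 / ε ^ 4 := by ring
  rw [eB] at h
  have ha2 : 0 ≤ a ^ 2 := sq_nonneg a
  have hA : 9 * a ^ 2 * (l * κ * (Δ + b₀) / ε ^ 2) ≤ T := by nlinarith
  have hB1 : 9 * a ^ 2 * (l * κ ^ 2 * Δ * σ ^ 2 / ε ^ 4) ≤ T := by nlinarith
  have hB2 : 9 * a ^ 2 * (l * κ ^ 2 * (b₀ ^ 2 / Δ) * σ ^ 2 / ε ^ 4) ≤ T := by nlinarith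
  have hA' : 3 * a * (l * κ * (Δ + b₀) / ε ^ 2) ≤ T := by
    refine le_trans (mul_le_mul_of_nonneg_right ?_ pA) hA
    nlinarith
  have t1 : a * l * κ / T * (Δ + b₀) ≤ ε ^ 2 / 3 := by
    calc a * l * κ / T * (Δ + b₀)
        = (3 * a * (l * κ * (Δ + b₀) / ε ^ 2)) * (ε ^ 2 / 3 / T) := by field_simp
      _ ≤ T * (ε ^ 2 / 3 / T) := by gcongr
      _ = ε ^ 2 / 3 := by field_simp
  have t2 : a * κ * √l * b₀ / √(Δ * T) * σ ≤ ε ^ 2 / 3 := by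
    refine (pow_le_pow_iff_left₀ (by positivity) (by positivity) two_ne_zero).1 ?_
    calc (a * κ * √l * b₀ / √(Δ * T) * σ) ^ 2
        = a ^ 2 * κ ^ 2 * √l ^ 2 * b₀ ^ 2 / √(Δ * T) ^ 2 * σ ^ 2 := by ring
      _ = (9 * a ^ 2 * (l * κ ^ 2 * (b₀ ^ 2 / Δ) * σ ^ 2 / ε ^ 4)) * (ε ^ 4 / 9 / T) := by
          rw [Real.sq_sqrt hl.le, Real.sq_sqrt (by positivity)]; field_simp
      _ ≤ T * (ε ^ 4 / 9 / T) := by gcongr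
      _ = (ε ^ 2 / 3) ^ 2 := by field_simp; norm_num
  have t3 : a * κ * √(l * Δ) / √T * σ ≤ ε ^ 2 / 3 := by
    refine (pow_le_pow_iff_left₀ (by positivity) (by positivity) two_ne_zero).1 ?_
    calc (a * κ * √(l * Δ) / √T * σ) ^ 2
        = a ^ 2 * κ ^ 2 * √(l * Δ) ^ 2 / √T ^ 2 * σ ^ 2 := by ring
      _ = (9 * a ^ 2 * (l * κ ^ 2 * Δ * σ ^ 2 / ε ^ 4)) * (ε ^ 4 / 9 / T) := by
          rw [Real.sq_sqrt (by positivity), eT]; field_simp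
      _ ≤ T * (ε ^ 4 / 9 / T) := by gcongr
      _ = (ε ^ 2 / 3) ^ 2 := by field_simp; norm_num
  linarith

/-- For `b₀ ≤ M * Δ` the sample size with explicit `b₀` is bounded up to a factor depending on
`M`. -/
lemma complexity_le_of_le_mul {Δ σ l κ b₀ ε M : ℝ} (hl : 0 < l) (hκ : 0 < κ)
    (hΔ : 0 < Δ) (hb₀ : 0 ≤ b₀) (hε : 0 < ε) (hM : b₀ ≤ M * Δ) :
    l * κ * (Δ + b₀) / ε ^ 2 + l * κ ^ 2 * (Δ + b₀ ^ 2 / Δ) * σ ^ 2 / ε ^ 4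
      ≤ (1 + |M|) ^ 2 * (l * κ * Δ / ε ^ 2 + l * κ ^ 2 * Δ * σ ^ 2 / ε ^ 4) := by
  have hM' : b₀ ≤ |M| * Δ := hM.trans (mul_le_mul_of_nonneg_right (le_abs_self M) hΔ.le)
  have h0 := abs_nonneg M
  have h1 : Δ + b₀ ≤ (1 + |M|) ^ 2 * Δ := by nlinarith [mul_nonneg h0 hΔ.le, sq_nonneg M]
  have h2 : b₀ ^ 2 / Δ ≤ |M| ^ 2 * Δ := by
    rw [div_le_iff₀ hΔ]
    calc b₀ ^ 2 ≤ (|M| * Δ) ^ 2 := pow_le_pow_left₀ hb₀ hM' 2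
      _ = _ := by ring
  have h3 : Δ + b₀ ^ 2 / Δ ≤ (1 + |M|) ^ 2 * Δ := by nlinarith [mul_nonneg h0 hΔ.le]
  calc _ ≤ l * κ * ((1 + |M|) ^ 2 * Δ) / ε ^ 2
        + l * κ ^ 2 * ((1 + |M|) ^ 2 * Δ) * σ ^ 2 / ε ^ 4 := by gcongr
    _ = _ := by ring

/-! ### The randomly chosen output -/

section Output

variable {Ω Ξ : Type*} [MeasurableSpace Ω] [MeasurableSpace Ξ] {P : Measure Ω}
  [IsProbabilityMeasure P]

lemma UniformIndex.ae_lt {ξ : ℕ → Ω → Ξ} {T : ℕ} {J : Ω → ℕ} (hJ : UniformIndex P ξ T J)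
    (hT : 1 ≤ T) : ∀ᵐ ω ∂P, J ω < T := by
  have hT0 : (T : ℝ) ≠ 0 := by exact_mod_cast (by lia : T ≠ 0)
  have h1 : P.real (J ⁻¹' (Finset.range T : Set ℕ)) = 1 := by
    rw [← sum_measureReal_preimage_singleton (Finset.range T)
      fun t _ => hJ.measurable (measurableSet_singleton t),
      Finset.sum_congr rfl fun t ht => hJ.uniform t (Finset.mem_range.1 ht)]
    simp [hT0]
  have h2 : P (J ⁻¹' (Finset.range T : Set ℕ)) = 1 := by
    exact (ENNReal.toReal_eq_one_iff _).1 h1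
  have h3 := (prob_compl_eq_zero_iff
    (hJ.measurable (Finset.measurableSet (Finset.range T)))).2 h2
  filter_upwards [measure_eq_zero_iff_ae_notMem.1 h3] with ω hω
  simpa using hω

/-- The expectation of a function of a uniformly chosen independent time is the average over all
times. -/
lemma UniformIndex.integral_eq {ξ : ℕ → Ω → Ξ} (hξ : ∀ i, Measurable (ξ i)) {T : ℕ} {J : Ω → ℕ}
    (hJ : UniformIndex P ξ T J) (hT : 1 ≤ T) {F : ℕ → (ℕ → Ξ) → ℝ} (hF : ∀ t, Measurable (F t))
    (hint : ∀ t < T, Integrable (fun ω => F t fun i => ξ i ω) P) :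
    Integrable (fun ω => F (J ω) fun i => ξ i ω) P ∧
      ∫ ω, F (J ω) (fun i => ξ i ω) ∂P
        = 1 / (T : ℝ) * ∑ t ∈ Finset.range T, ∫ ω, F t (fun i => ξ i ω) ∂P := by
  have hs : Measurable fun ω i => ξ i ω := measurable_pi_lambda _ hξ
  have hind : ∀ t, Measurable fun n : ℕ => if n = t then (1 : ℝ) else 0 := fun t =>
    measurable_from_nat
  have hterm : ∀ t < T, Integrable
      (fun ω => (if J ω = t then (1 : ℝ) else 0) * F t fun i => ξ i ω) P ∧
      ∫ ω, (if J ω = t then (1 : ℝ) else 0) * F t (fun i => ξ i ω) ∂P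
        = 1 / (T : ℝ) * ∫ ω, F t (fun i => ξ i ω) ∂P := fun t ht => by
    have hI : IndepFun (fun ω => if J ω = t then (1 : ℝ) else 0)
      (fun ω => F t fun i => ξ i ω) P := hJ.indep.comp (hind t) (hF t)
    have e : (fun ω => if J ω = t then (1 : ℝ) else 0) = (J ⁻¹' {t}).indicator 1 := by
      funext ω
      by_cases h : J ω = t
      · rw [if_pos h, Set.indicator_of_mem (show ω ∈ J ⁻¹' {t} from h), Pi.one_apply]
      · rw [if_neg h, Set.indicator_of_notMem (show ω ∉ J ⁻¹' {t} from h)]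
    have hm : MeasurableSet (J ⁻¹' {t}) := hJ.measurable (measurableSet_singleton t)
    have hi : Integrable (fun ω => if J ω = t then (1 : ℝ) else 0) P := by
      rw [e]
      exact (integrable_const (1 : ℝ)).indicator hm
    refine ⟨hI.integrable_mul hi (hint t ht), ?_⟩
    rw [hI.integral_fun_mul_eq_mul_integral hi.aestronglyMeasurable
      (hint t ht).aestronglyMeasurable, e, integral_indicator_one hm, hJ.uniform t ht]
  have hae : (fun ω => F (J ω) fun i => ξ i ω) =ᵐ[P] fun ω => ∑ t ∈ Finset.range T,
      (if J ω = t then (1 : ℝ) else 0) * F t fun i => ξ i ω := by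
    filter_upwards [hJ.ae_lt hT] with ω hω
    simp [Finset.sum_ite_eq, hω]
  refine ⟨(integrable_finsetSum _ fun t ht =>
    (hterm t (Finset.mem_range.1 ht)).1).congr hae.symm, ?_⟩
  rw [integral_congr_ae hae,
    integral_finsetSum _ fun t ht => (hterm t (Finset.mem_range.1 ht)).1, Finset.mul_sum]
  exact Finset.sum_congr rfl fun t ht => (hterm t (Finset.mem_range.1 ht)).2

/-- Jensen's inequality for the square. -/
lemma integral_le_of_integral_sq_le {N : Ω → ℝ} (hN : AEStronglyMeasurable N P) {a : ℝ}
    (ha : 0 < a) (hsq : Integrable (fun ω => N ω ^ 2) P) (h : ∫ ω, N ω ^ 2 ∂P ≤ a ^ 2) :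
    Integrable N P ∧ ∫ ω, N ω ∂P ≤ a := by
  have hint : Integrable N P := ((memLp_two_iff_integrable_sq hN).2 hsq).integrable one_le_two
  refine ⟨hint, ?_⟩
  have h1 : ∫ ω, 2 * a * N ω ∂P ≤ ∫ ω, (N ω ^ 2 + a ^ 2) ∂P :=
    integral_mono (hint.const_mul _) (hsq.add (integrable_const _)) fun ω => by
      change 2 * a * N ω ≤ N ω ^ 2 + a ^ 2
      nlinarith [sq_nonneg (N ω - a)]
  rw [integral_const_mul, integral_add hsq (integrable_const _)] at h1
  simp only [integral_const, probReal_univ, one_smul] at h1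
  have h2 : a * ∫ ω, N ω ∂P ≤ a * a := by linarith
  exact le_of_mul_le_mul_left h2 ha

lemma isExpectedStationary_of_integral_sq_le {d₁ d₂ : ℕ} {f : Vec d₁ → Vec d₂ → ℝ}
    {X : Ω → Vec d₁} {Y : Ω → Vec d₂} {κ ε : ℝ} (hκ : 0 < κ) (hε : 0 < ε)
    (hX : Measurable fun ω => gradX f (X ω) (Y ω)) (hY : Measurable fun ω => gradY f (X ω) (Y ω))
    (hint : Integrable
      (fun ω => ‖gradX f (X ω) (Y ω)‖ ^ 2 + κ * ‖gradY f (X ω) (Y ω)‖ ^ 2) P)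
    (h : ∫ ω, (‖gradX f (X ω) (Y ω)‖ ^ 2 + κ * ‖gradY f (X ω) (Y ω)‖ ^ 2) ∂P ≤ ε ^ 2) :
    IsExpectedStationary P f X Y ε (ε / √κ) := by
  have hXi : Integrable (fun ω => ‖gradX f (X ω) (Y ω)‖ ^ 2) P := by
    refine hint.mono' (hX.norm.pow_const 2).aestronglyMeasurable (.of_forall fun ω => ?_)
    rw [Real.norm_of_nonneg (sq_nonneg _)]
    linarith [mul_nonneg hκ.le (sq_nonneg ‖gradY f (X ω) (Y ω)‖)]
  have hYi : Integrable (fun ω => κ * ‖gradY f (X ω) (Y ω)‖ ^ 2) P := by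
    refine hint.mono' ((hY.norm.pow_const 2).const_mul κ).aestronglyMeasurable
      (.of_forall fun ω => ?_)
    rw [Real.norm_of_nonneg (mul_nonneg hκ.le (sq_nonneg _))]
    linarith [sq_nonneg ‖gradX f (X ω) (Y ω)‖]
  rw [integral_add hXi hYi] at h
  have h1 : 0 ≤ ∫ ω, ‖gradX f (X ω) (Y ω)‖ ^ 2 ∂P := integral_nonneg fun _ => sq_nonneg _
  have h2 : 0 ≤ ∫ ω, κ * ‖gradY f (X ω) (Y ω)‖ ^ 2 ∂P :=
    integral_nonneg fun _ => mul_nonneg hκ.le (sq_nonneg _)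
  refine ⟨integral_le_of_integral_sq_le hX.norm.aestronglyMeasurable hε hXi (by linarith),
    integral_le_of_integral_sq_le hY.norm.aestronglyMeasurable
      (div_pos hε (Real.sqrt_pos.2 hκ)) ?_ ?_⟩
  · exact (integrable_const_mul_iff hκ.ne'.isUnit _).1 hYi
  · rw [integral_const_mul] at h
    rw [div_pow, Real.sq_sqrt hκ.le, le_div_iff₀ hκ]
    linarith

end Output

end SmoothedAGDA

namespace SmoothedAGDA

/-! ### The convergence theorem -/

section Final

variable {d₁ d₂ : ℕ} {Ξ : Type*} [MeasurableSpace Ξ] {D : Measure Ξ}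
  {f : Vec d₁ → Vec d₂ → ℝ} {Gx : Vec d₁ → Vec d₂ → Ξ → Vec d₁}
  {Gy : Vec d₁ → Vec d₂ → Ξ → Vec d₂} {l σ : ℝ}

/-- The iterates are measurable functions of the whole sample stream. -/
lemma measurable_run (hGx : StochasticGradient D Gx (gradX f) σ)
    (hGy : StochasticGradient D Gy (gradY f) σ) (τ₁ τ₂ p β : ℝ) (x₀ : Vec d₁) (y₀ : Vec d₂)
    (z₀ : Vec d₁) (t : ℕ) :
    Measurable fun s : ℕ → Ξ => ((run Gx Gy τ₁ τ₂ p β x₀ y₀ z₀ s t).x,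
      (run Gx Gy τ₁ τ₂ p β x₀ y₀ z₀ s t).y) := by
  have h := (isIterates_run Gx Gy τ₁ τ₂ p β x₀ y₀ z₀ (fun i (s : ℕ → Ξ) => s i)).measurable
    hGx hGy t
  have hle := samplesBefore_le (fun i => measurable_pi_apply (X := fun _ : ℕ => Ξ) i) (2 * t)
  exact (h.1.mono hle le_rfl).prodMk (h.2.1.mono hle le_rfl)

/-- If the stationarity measure averaged over the iterations is at most `ε ^ 2`, the uniformly
chosen iterate is expected stationary. -/
lemma isExpectedStationary_output {Ω : Type*} [MeasurableSpace Ω] {P : Measure Ω}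
    [IsProbabilityMeasure P] {ξ : ℕ → Ω → Ξ} (hf : LipschitzSmooth f l) (hl : 0 < l)
    (hGx : StochasticGradient D Gx (gradX f) σ) (hGy : StochasticGradient D Gy (gradY f) σ)
    (hξ : ∀ i, Measurable (ξ i)) {τ₁ τ₂ p β κ ε : ℝ} {x₀ : Vec d₁} {y₀ : Vec d₂} {z₀ : Vec d₁}
    {w : ℕ → Ω → State d₁ d₂}
    (hw : ∀ t ω, w t ω = run Gx Gy τ₁ τ₂ p β x₀ y₀ z₀ (fun i => ξ i ω) t)
    {T : ℕ} (hT : 1 ≤ T) (hκ : 0 < κ) (hε : 0 < ε)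
    (hint : ∀ t < T, Integrable (fun ω => ‖gradX f (w t ω).x (w t ω).y‖ ^ 2
      + κ * ‖gradY f (w t ω).x (w t ω).y‖ ^ 2) P)
    (hle : 1 / (T : ℝ) * ∑ t ∈ Finset.range T, ∫ ω, (‖gradX f (w t ω).x (w t ω).y‖ ^ 2
      + κ * ‖gradY f (w t ω).x (w t ω).y‖ ^ 2) ∂P ≤ ε ^ 2)
    {J : Ω → ℕ} (hJ : UniformIndex P ξ T J) :
    IsExpectedStationary P f (fun ω => (w (J ω) ω).x) (fun ω => (w (J ω) ω).y) ε (ε / √κ) := by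
  have hrun := measurable_run hGx hGy τ₁ τ₂ p β x₀ y₀ z₀
  have hgX := fun t => (hf.continuous_gradX hl).measurable.comp (hrun t)
  have hgY := fun t => (hf.continuous_gradY hl).measurable.comp (hrun t)
  have hJξ : Measurable fun ω => ((fun i => ξ i ω : ℕ → Ξ), J ω) :=
    (measurable_pi_lambda _ hξ).prodMk hJ.measurable
  simp only [hw] at hint hle ⊢
  have hF : ∀ t, Measurable fun s : ℕ → Ξ =>
      ‖gradX f (run Gx Gy τ₁ τ₂ p β x₀ y₀ z₀ s t).x (run Gx Gy τ₁ τ₂ p β x₀ y₀ z₀ s t).y‖ ^ 2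
      + κ * ‖gradY f (run Gx Gy τ₁ τ₂ p β x₀ y₀ z₀ s t).x
          (run Gx Gy τ₁ τ₂ p β x₀ y₀ z₀ s t).y‖ ^ 2 := fun t =>
    ((hgX t).norm.pow_const 2).add (((hgY t).norm.pow_const 2).const_mul κ)
  have hout := hJ.integral_eq hξ hT hF hint
  refine isExpectedStationary_of_integral_sq_le hκ hε ?_ ?_ hout.1 (hout.2.trans_le hle)
  · have h : Measurable fun q : (ℕ → Ξ) × ℕ => gradX f
        (run Gx Gy τ₁ τ₂ p β x₀ y₀ z₀ q.1 q.2).x (run Gx Gy τ₁ τ₂ p β x₀ y₀ z₀ q.1 q.2).y :=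
      measurable_from_prod_countable_left hgX
    exact h.comp hJξ
  · have h : Measurable fun q : (ℕ → Ξ) × ℕ => gradY f
        (run Gx Gy τ₁ τ₂ p β x₀ y₀ z₀ q.1 q.2).x (run Gx Gy τ₁ τ₂ p β x₀ y₀ z₀ q.1 q.2).y :=
      measurable_from_prod_countable_left hgY
    exact h.comp hJξ

end Final

end SmoothedAGDA

end

theorem theorem2 :
    ∃ (c₀ c₁ c₂ c : ℝ) (C : ℝ → ℝ), 0 < c₀ ∧ 0 < c₁ ∧ 0 < c₂ ∧ 0 < c ∧ (∀ M, 0 < C M) ∧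
    ∀ (d₁ d₂ : ℕ) (f : SmoothedAGDA.Vec d₁ → SmoothedAGDA.Vec d₂ → ℝ) (l μ σ κ Φstar : ℝ)
      (Ξ : Type*) [MeasurableSpace Ξ] (D : Measure Ξ) [IsProbabilityMeasure D]
      (Gx : SmoothedAGDA.Vec d₁ → SmoothedAGDA.Vec d₂ → Ξ → SmoothedAGDA.Vec d₁)
      (Gy : SmoothedAGDA.Vec d₁ → SmoothedAGDA.Vec d₂ → Ξ → SmoothedAGDA.Vec d₂)
      (Ω : Type*) [MeasurableSpace Ω] (P : Measure Ω) [IsProbabilityMeasure P]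
      (ξ : ℕ → Ω → Ξ)
      (x₀ : SmoothedAGDA.Vec d₁) (y₀ : SmoothedAGDA.Vec d₂) (z₀ : SmoothedAGDA.Vec d₁)
      (T : ℕ) (Δ b₀ τ₁ τ₂ p β : ℝ) (w : ℕ → Ω → SmoothedAGDA.State d₁ d₂),
      -- standing assumptions on the objective and the stochastic gradients
      0 < l → 0 < μ → μ ≤ l → κ = l / μ → 0 < σ →
      SmoothedAGDA.LipschitzSmooth f l →
      SmoothedAGDA.PLInY f μ →
      (∀ x, Φstar ≤ SmoothedAGDA.primal f x) →
      SmoothedAGDA.StochasticGradient D Gx (SmoothedAGDA.gradX f) σ →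
      SmoothedAGDA.StochasticGradient D Gy (SmoothedAGDA.gradY f) σ →
      SmoothedAGDA.IIDSamples P D ξ →
      -- initial quantities and parameters of the algorithm
      1 ≤ T →
      Δ = SmoothedAGDA.primal f z₀ - Φstar → 0 < Δ →
      b₀ = 2 * SmoothedAGDA.gap (SmoothedAGDA.aux f p z₀) x₀ y₀ →
      τ₁ = min (√Δ / (2 * σ * √(T * l))) (1 / (3 * l)) →
      τ₂ = min (√Δ / (96 * σ * √(T * l))) (1 / (144 * l)) →
      p = 2 * l → β = τ₂ * μ / 1600 →
      (∀ t ω, w t ω = SmoothedAGDA.run Gx Gy τ₁ τ₂ p β x₀ y₀ z₀ (fun i => ξ i ω) t) →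
      -- the convergence rate
      ((∀ t < T, Integrable (fun ω => ‖SmoothedAGDA.gradX f (w t ω).x (w t ω).y‖ ^ 2
            + κ * ‖SmoothedAGDA.gradY f (w t ω).x (w t ω).y‖ ^ 2) P) ∧
        1 / (T : ℝ) * ∑ t ∈ Finset.range T,
            ∫ ω, (‖SmoothedAGDA.gradX f (w t ω).x (w t ω).y‖ ^ 2
              + κ * ‖SmoothedAGDA.gradY f (w t ω).x (w t ω).y‖ ^ 2) ∂P
          ≤ c₀ * l * κ / T * (Δ + b₀) + c₁ * κ * √l * b₀ / √(Δ * T) * σ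
            + c₂ * κ * √(l * Δ) / √T * σ) ∧
      -- the number of samples drawn in `T` iterations
      (∀ ω, (w T ω).drawn = 2 * T) ∧
      -- the sample complexity: with explicit dependence on `b₀`, and for `b₀ ≤ M * Δ`
      (∀ (J : Ω → ℕ) (ε : ℝ), SmoothedAGDA.UniformIndex P ξ T J → 0 < ε →
        (c * (l * κ * (Δ + b₀) / ε ^ 2 + l * κ ^ 2 * (Δ + b₀ ^ 2 / Δ) * σ ^ 2 / ε ^ 4)
            ≤ ((2 * T : ℕ) : ℝ) →
          SmoothedAGDA.IsExpectedStationary P f (fun ω => (w (J ω) ω).x)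
            (fun ω => (w (J ω) ω).y) ε (ε / √κ)) ∧
        (∀ M : ℝ, b₀ ≤ M * Δ →
          C M * (l * κ * Δ / ε ^ 2 + l * κ ^ 2 * Δ * σ ^ 2 / ε ^ 4) ≤ ((2 * T : ℕ) : ℝ) →
          SmoothedAGDA.IsExpectedStationary P f (fun ω => (w (J ω) ω).x)
            (fun ω => (w (J ω) ω).y) ε (ε / √κ))) := by
  -- `18 * a ^ 2` with `a = 46080000` is what `rate_le_sq` requires for the coefficients `a`
  refine ⟨46080000, 46080000, 46080000, 18 * 46080000 ^ 2,
    fun M => 18 * 46080000 ^ 2 * (1 + |M|) ^ 2, by norm_num, by norm_num, by norm_num,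
    by norm_num, fun M => by positivity, ?_⟩
  intro d₁ d₂ f l μ σ κ Φstar Ξ _ D _ Gx Gy Ω _ P _ ξ x₀ y₀ z₀ T Δ b₀ τ₁ τ₂ p β w hl hμ hμl hκ hσ
    hf hpl hΦ hGx hGy hξ hT hΔ hΔ0 hb₀ hτ₁ hτ₂ hp hβ hw
  have hκ0 : 0 < κ := by rw [hκ]; positivity
  have hT0 : (0 : ℝ) < T := by exact_mod_cast hT
  have hb₀0 : 0 ≤ b₀ := by
    rw [hb₀, hp]
    linarith [SmoothedAGDA.gap_aux_nonneg hf hpl hl x₀ y₀ z₀]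
  have hit := SmoothedAGDA.isIterates_run Gx Gy τ₁ τ₂ p β x₀ y₀ z₀ ξ
  simp only [← hw] at hit
  have hmem := hit.memLp hf hl hGx hGy hξ
  have hint : ∀ t, Integrable (fun ω => ‖SmoothedAGDA.gradX f (w t ω).x (w t ω).y‖ ^ 2
      + κ * ‖SmoothedAGDA.gradY f (w t ω).x (w t ω).y‖ ^ 2) P := fun t =>
    ((SmoothedAGDA.memLp_gradX hf hl (hmem t).1 (hmem t).2.1).integrable_norm_pow
      two_ne_zero).add (((SmoothedAGDA.memLp_gradY hf hl (hmem t).1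
        (hmem t).2.1).integrable_norm_pow two_ne_zero).const_mul κ)
  have hτ : τ₁ = 48 * τ₂ := by rw [hτ₁, hτ₂]; exact SmoothedAGDA.step_size_ratio Δ σ l T
  have hτ₂0 : 0 < τ₂ := by rw [hτ₂]; positivity
  have hτl : 144 * l * τ₂ ≤ 1 := by
    have h : τ₂ ≤ 1 / (144 * l) := hτ₂ ▸ min_le_right _ _
    rwa [le_div_iff₀ (by positivity), mul_comm] at h
  rw [hp] at hit
  have hsum := hit.sum_integral_le hf hpl hμ hμl hGx hGy hξ hΦ hτ₂0 hτ hτl hβ T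
  have hrate := SmoothedAGDA.rate_of_potential_bound (S := ∑ t ∈ Finset.range T,
      ∫ ω, (‖SmoothedAGDA.gradX f (w t ω).x (w t ω).y‖ ^ 2
        + κ * ‖SmoothedAGDA.gradY f (w t ω).x (w t ω).y‖ ^ 2) ∂P)
    hl hμ hκ hσ hT hΔ0 hb₀0 hτ₁ hτ₂ (by
      refine le_trans (le_of_eq ?_) (hsum.trans (le_of_eq ?_))
      · rw [Finset.mul_sum]
        refine Finset.sum_congr rfl fun t _ => ?_
        rw [← integral_const_mul]
        refine integral_congr_ae (.of_forall fun ω => ?_)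
        have : μ * κ = l := by rw [hκ]; field_simp
        simp only [← this]
        ring
      · rw [hΔ, hb₀, hp]; ring)
  have hstat : ∀ (J : Ω → ℕ) (ε : ℝ), SmoothedAGDA.UniformIndex P ξ T J → 0 < ε →
      18 * 46080000 ^ 2 * (l * κ * (Δ + b₀) / ε ^ 2
        + l * κ ^ 2 * (Δ + b₀ ^ 2 / Δ) * σ ^ 2 / ε ^ 4) ≤ ((2 * T : ℕ) : ℝ) →
      SmoothedAGDA.IsExpectedStationary P f (fun ω => (w (J ω) ω).x)
        (fun ω => (w (J ω) ω).y) ε (ε / √κ) := fun J ε hJ hε hc =>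
    SmoothedAGDA.isExpectedStationary_output hf hl hGx hGy hξ.measurable hw hT hκ0 hε
      (fun t _ => hint t) (hrate.trans (SmoothedAGDA.rate_le_sq (by norm_num) hl hκ0 hσ hT hΔ0
        hb₀0 hε hc)) hJ
  refine ⟨⟨fun t _ => hint t, hrate⟩, fun ω => by rw [hw]; exact SmoothedAGDA.run_drawn .., ?_⟩
  refine fun J ε hJ hε => ⟨hstat J ε hJ hε, fun M hM hc => hstat J ε hJ hε (le_trans ?_ hc)⟩
  have h := SmoothedAGDA.complexity_le_of_le_mul (σ := σ) hl hκ0 hΔ0 hb₀0 hε hM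
  rw [mul_assoc (18 * 46080000 ^ 2 : ℝ)]
  exact mul_le_mul_of_nonneg_left h (by norm_num)
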